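/- Let $Q=(q_n)_{n\ge1}$ be a computable sequence of integers $q_n\ge 2$ which is computably growing, i.e. $q_n\to\infty$ and the sequence $n\mapsto\inf\{i\ge 1: q_j\ge n\text{ for all }j\ge i\}$ is computable. *Construction.* Write $\lambda$ for Lebesgue measure and let $f(x)=x$ on $[0,1]$. For $j\ge 1$ put $\Delta_j=\min_{0\le m<j}\lambda\big(f^{-1}[\tfrac mj,\tfrac{m+1}j)\big)$ $(=1/j)$ and $$\nu^*_j=\min\Big\{t\ge 1:\ \min\big\{\sqrt{\log q_k},\sqrt{\log(q_1\cdots q_{k-1})}\big\}\ge\log 4-\log\Delta_j\ \text{ for all }k\ge t\Big\}.$$ Given a sequence $\nu=(\nu_j)$ of natural numbers with $\nu_j\ge\nu_j^*$ for all $j\ge1$, put $L_0=0$, $l_1=\max\{\nu_2-1,1\}$, and inductively $$L_j=\sum_{i=1}^j i!\,i\,l_i,\qquad l_j=\max\big\{\min\{t\in\mathbb N: L_{j-1}+j!\,j\,t\ge\nu_j-1\},\ j^2\big\}\quad(j\ge2).$$ For $n\ge1$ let $i(n)$ be the $i\ge1$ with $L_{i-1}<n\le L_i$, and let $c(n)$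 be the integer $c$ in the unique representation $n=L_{i-1}+b\,i!\,i+c\,i!+d$ with $i=i(n)$, $0\le b<l_i$, $0\le c<i$, $1\le d\le i!$. Define $$\alpha_\nu(n)=\Big\lceil \inf\Big(q_n\, f^{-1}\Big[\frac{c(n)}{i(n)},\frac{c(n)+1}{i(n)}\Big)\Big)\Big\rceil ,\qquad \xi_\nu=\sum_{n=1}^\infty\frac{\alpha_\nu(n)}{q_1q_2\cdots q_n}.$$ **Theorem.** 1. For every $\nu$ with $\nu_j\ge\nu^*_j$ for all $j\ge1$ (in particular for $\nu=\nu^*$), the series $\xi_\nu$ converges and $\xi_\nu$ is $Q$-distribution normal: the sequence $(q_1\cdots q_n\,\xi_\nu \bmod 1)_{n\ge0}$ is uniformly distributed mod $1$. If moreover $\nu$ is a computable sequence, then $\xi_\nu$ is a computable real number, i.e. in some base $b\ge2$ its digits are given by a total recursive function. 2. There is a computable sequence $\nu$ with $\nu_j\ge\nu_j^*$ for all $j\ge 1$. 3. If the set of $j\in\mathbb N$ for which $(4j)^{\log(4j)}$ is an integer is decidable (for instance if it is finite), then the number $\xi_{\nu^*}$ is computable. -/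

import Mathlib

open Filter Topology Set
open scoped Nat

noncomputable section

namespace CantorSeries

/- A sequence `q₁, q₂, …` is a function `q : ℕ → ℕ` read at the indices `n ≥ 1`; the value `q 0`
is never used. -/

/-- A basic sequence: all terms `q₁, q₂, …` are at least `2`. -/
def IsBasic (q : ℕ → ℕ) : Prop := ∀ n, 1 ≤ n → 2 ≤ q n

/-- The product `q₁ q₂ ⋯ qₙ`. -/
def prodTo (q : ℕ → ℕ) (n : ℕ) : ℕ := ∏ k ∈ Finset.Icc 1 n, q k

/-- `q` is infinite in limit and `n ↦ inf {i : q_j ≥ n for all j ≥ i}` is computable. -/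
def ComputablyGrowing (q : ℕ → ℕ) : Prop :=
  Tendsto q atTop atTop ∧
    Computable (fun n : ℕ => sInf {i : ℕ | 1 ≤ i ∧ ∀ j, i ≤ j → n ≤ q j})

/-- In some base `b ≥ 2` the digits of `x` after the radix point are given by a total recursive
function. -/
def IsComputableReal (x : ℝ) : Prop :=
  ∃ b : ℕ, 2 ≤ b ∧ ∃ f : ℕ → ℕ, Computable f ∧
    ∀ n, (f n : ℤ) = ⌊(b : ℝ) ^ (n + 1) * x⌋ % (b : ℤ)

/-- The sequence `ω` in `[0,1)` has asymptotic distribution function `g`. -/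
def HasADF (ω : ℕ → ℝ) (g : ℝ → ℝ) : Prop :=
  ∀ x ∈ Icc (0 : ℝ) 1,
    Tendsto (fun n : ℕ => (((Finset.range n).filter (fun i => ω i ∈ Ico 0 x)).card : ℝ) / n)
      atTop (𝓝 (g x))

/-- `T_{Q,n}(x) = q₁ ⋯ qₙ x mod 1`. -/
def T (q : ℕ → ℕ) (x : ℝ) (n : ℕ) : ℝ := Int.fract ((prodTo q n : ℝ) * x)

/-- `x` is `Q`-distribution normal: `(T_{Q,n}(x))_{n ≥ 0}` is uniformly distributed mod `1`. -/
def IsDistributionNormal (q : ℕ → ℕ) (x : ℝ) : Prop := HasADF (T q x) (fun t => t)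

/- The construction for the single polynomial `X`, where the upper and lower asymptotic
distribution functions along every arithmetic progression, and all their continuous
approximations, are one and the same continuous function `g`. -/

/-- `g⁻¹([j/k, (j+1)/k))`, as a subset of `[0,1]`. -/
def preimageCell (g : ℝ → ℝ) (k j : ℕ) : Set ℝ :=
  {x | x ∈ Icc (0 : ℝ) 1 ∧ g x ∈ Ico ((j : ℝ) / k) (((j : ℝ) + 1) / k)}

/-- `Δ_k`: the smallest Lebesgue measure of the sets `g⁻¹([j/k, (j+1)/k))`, `0 ≤ j < k`. -/
def Delta (g : ℝ → ℝ) (k : ℕ) : ℝ :=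
  ⨅ j : Fin k, (MeasureTheory.volume (preimageCell g k j)).toReal

/-- `ν_j`: the least `t ≥ 1` such that
`min ((log q_k)^{1/2}) ((log (q₁ ⋯ q_{k-1}))^{1/2}) ≥ log 4 - log Δ_j` for all `k ≥ t`. -/
def nu (q : ℕ → ℕ) (g : ℝ → ℝ) (j : ℕ) : ℕ :=
  sInf {t : ℕ | 1 ≤ t ∧ ∀ k, t ≤ k →
    Real.log 4 - Real.log (Delta g j) ≤
      min (Real.sqrt (Real.log (q k))) (Real.sqrt (Real.log (prodTo q (k - 1))))}

/-- `l_j` as a function of `p = L_{j-1}`. -/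
def ell (ν : ℕ → ℕ) (j p : ℕ) : ℕ :=
  if j = 1 then max (ν 2 - 1) 1
  else max (sInf {t : ℕ | ν j - 1 ≤ p + j ! * j * t}) (j ^ 2)

/-- `L_j = ∑_{i=1}^{j} i! i l_i`. -/
def bigL (ν : ℕ → ℕ) : ℕ → ℕ
  | 0 => 0
  | j + 1 => bigL ν j + (j + 1)! * (j + 1) * ell ν (j + 1) (bigL ν j)

/-- `i(n)`: the index `i ≥ 1` with `L_{i-1} < n ≤ L_i` (for `n ≥ 1`). -/
def stage (ν : ℕ → ℕ) (n : ℕ) : ℕ := sInf {i : ℕ | n ≤ bigL ν i}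

/-- `c(n)`: the number `c` in the unique representation `n = L_{i-1} + b i! i + c i! + d` with
`i = i(n)`, `0 ≤ b < l_i`, `0 ≤ c < i` and `1 ≤ d ≤ i!`. -/
def cell (ν : ℕ → ℕ) (n : ℕ) : ℕ :=
  (n - bigL ν (stage ν n - 1) - 1) / (stage ν n)! % stage ν n

/-- `α(n) = ⌈inf (q_n g⁻¹([c(n)/i(n), (c(n)+1)/i(n))))⌉`. -/
def alpha (q : ℕ → ℕ) (g : ℝ → ℝ) (ν : ℕ → ℕ) (n : ℕ) : ℤ :=
  ⌈sInf ((fun x : ℝ => (q n : ℝ) * x) '' preimageCell g (stage ν n) (cell ν n))⌉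

/-- The real number `∑_{n ≥ 1} α(n) / (q₁ ⋯ qₙ)`. -/
def xi (q : ℕ → ℕ) (g : ℝ → ℝ) (ν : ℕ → ℕ) : ℝ :=
  ∑' n : ℕ, (alpha q g ν (n + 1) : ℝ) / (prodTo q (n + 1) : ℝ)

end CantorSeries

end

/-! Normality. In stage `i` the digit is `⌈q_n c / i⌉`, so `q₁ ⋯ qₙ ξ` lies above an integer plus `c
/ i` by less than `3 / qₙ₊₁`: less than one unit from the ceiling, at most two from the tail. Past
`L_j` the bound `q_n ≥ (4 j) ^ log (4 j)` forces `3 (j + 1) ≤ q_n`, hence the orbit stays in the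
prescribed cell (`T_xi_mem_Ico_of_bigL`). A full period of `i! i` terms visits each of the `i` cells
`i!` times, so its counting error for `[0, x)` is at most `i!`, a proportion `1 / i`. An unfinished
period is negligible, since `l_j ≥ j ^ 2` makes `L_j` at least `j! j ^ 3`.

Computability. The partial sums are fractions `A n / P n` with computable numerators and error at
most `2 / P n`. Digits can be read off by search if the limit is irrational; a rational limit needs
no search (`isComputableReal_of_approx`).

The least choice. As `Δ_j = 1 / j`, the condition defining `ν*_j` says that `q_k` and `q₁ ⋯ q_{k-1}`
are at least `θ_j = (4 j) ^ log (4 j)`, equivalently `⌈θ_j⌉`. Thus `ν*_j` is a computable function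
(`growthIndex`) of `⌈θ_j⌉`. Replacing `θ_j` by the larger integer `(4 j) ^ (4 j)` gives a computable
`ν`. To compute `⌈θ_j⌉` itself, strict inequalities between `θ_j` and integers are semidecidable;
the only obstruction is equality, which the decidability hypothesis settles. -/

namespace CantorSeries

/-! ### Closure properties of computable functions; unbounded search -/

section Computability

variable {α : Type*} [Primcodable α] {f g h : α → ℕ}

theorem computable_add (hf : Computable f) (hg : Computable g) : Computable fun a => f a + g a :=
  Primrec.nat_add.to_comp.comp hf hg

theorem computable_sub (hf : Computable f) (hg : Computable g) : Computable fun a => f a - g a :=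
  Primrec.nat_sub.to_comp.comp hf hg

theorem computable_mul (hf : Computable f) (hg : Computable g) : Computable fun a => f a * g a :=
  Primrec.nat_mul.to_comp.comp hf hg

theorem computable_div (hf : Computable f) (hg : Computable g) : Computable fun a => f a / g a :=
  Primrec.nat_div.to_comp.comp hf hg

theorem computable_mod (hf : Computable f) (hg : Computable g) : Computable fun a => f a % g a :=
  Primrec.nat_mod.to_comp.comp hf hg

theorem computable_max (hf : Computable f) (hg : Computable g) :
    Computable fun a => max (f a) (g a) :=
  Primrec.nat_max.to_comp.comp hf hg

theorem computable_rec {g : ℕ → ℕ → ℕ} (c : ℕ) (hg : Computable₂ g) (hf : Computable f) :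
    Computable fun a => Nat.rec (motive := fun _ => ℕ) c (fun n r => g n r) (f a) :=
  Computable.nat_rec hf (Computable.const c)
    (hg.comp (Computable.fst.comp Computable.snd) (Computable.snd.comp Computable.snd)).to₂

theorem computable_pow (hf : Computable f) (hg : Computable g) :
    Computable fun a => f a ^ g a := by
  refine (Computable.nat_rec (h := fun a p => p.2 * f a) hg (Computable.const 1)
    (computable_mul (Computable.snd.comp Computable.snd) (hf.comp Computable.fst)).to₂).of_eq ?_
  intro a
  induction g a with
  | zero => rfl
  | succ n ih => simp [ih, pow_succ]

theorem computable_factorial (hf : Computable f) : Computable fun a => (f a)! := by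
  refine (computable_rec (g := fun n r => (n + 1) * r) 1
    (computable_mul (Computable.succ.comp Computable.fst) Computable.snd).to₂ hf).of_eq ?_
  intro a
  induction f a with
  | zero => rfl
  | succ n ih => simp [ih, Nat.factorial_succ]

theorem computablePred_le (hf : Computable f) (hg : Computable g) :
    ComputablePred fun a => f a ≤ g a :=
  (Primrec.nat_le.decide.to_comp.comp hf hg).computablePred

theorem computablePred_lt (hf : Computable f) (hg : Computable g) :
    ComputablePred fun a => f a < g a :=
  (Primrec.nat_lt.decide.to_comp.comp hf hg).computablePred

theorem computablePred_eq (hf : Computable f) (hg : Computable g) :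
    ComputablePred fun a => f a = g a :=
  (Primrec.eq.decide.to_comp.comp hf hg).computablePred

theorem computablePred_and {p r : α → Prop} (hp : ComputablePred p) (hr : ComputablePred r) :
    ComputablePred fun a => p a ∧ r a := by
  classical
  refine ComputablePred.of_eq (p := fun a => (decide (p a) && decide (r a)) = true)
    (Computable.computablePred ?_) (by simp)
  exact (Primrec.and.to_comp.comp hp.decide hr.decide).of_eq fun a => by simp

theorem computablePred_comp {β : Type*} [Primcodable β] {p : β → Prop} {k : α → β}
    (hp : ComputablePred p) (hk : Computable k) : ComputablePred fun a => p (k a) := by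
  classical
  exact (hp.decide.comp hk).computablePred

theorem computable_ite {p : α → Prop} [DecidablePred p] {β : Type*} [Primcodable β] {k l : α → β}
    (hp : ComputablePred p) (hk : Computable k) (hl : Computable l) :
    Computable fun a => if p a then k a else l a := by
  simpa [Bool.cond_decide] using hp.decide.cond hk hl

theorem computable_sInf {P : α → ℕ → Prop}
    (hP : ComputablePred fun p : α × ℕ => P p.1 p.2) (hex : ∀ a, ∃ n, P a n) :
    Computable fun a => sInf {n | P a n} := by
  classical
  refine (Computable.find hP hex).of_eq fun a => ?_
  exact (Nat.sInf_def (s := {n | P a n}) (hex a)).symm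

/-- A function is computable if its values are determined by a decidable relation with a
witness. -/
theorem computable_of_search {γ : Type*} [Denumerable γ] {R : α → ℕ → γ → Prop}
    (hR : ComputablePred fun p : α × ℕ × γ => R p.1 p.2.1 p.2.2)
    (hex : ∀ a, ∃ n c, R a n c) (huniq : ∀ a n c, R a n c → n = f a) : Computable f := by
  have hof : Computable fun p : α × ℕ => (p.1, Denumerable.ofNat (ℕ × γ) p.2) :=
    Computable.fst.pair ((Computable.ofNat (ℕ × γ)).comp Computable.snd)
  have hex' : ∀ a, ∃ m, R a (Denumerable.ofNat (ℕ × γ) m).1 (Denumerable.ofNat (ℕ × γ) m).2 := by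
    intro a
    obtain ⟨n, c, hc⟩ := hex a
    exact ⟨Encodable.encode (n, c), by rw [Denumerable.ofNat_encode]; exact hc⟩
  have hs := computable_sInf (P := fun a m => R a (Denumerable.ofNat (ℕ × γ) m).1
    (Denumerable.ofNat (ℕ × γ) m).2) (computablePred_comp hR hof) hex'
  refine (Computable.fst.comp ((Computable.ofNat (ℕ × γ)).comp hs)).of_eq fun a => ?_
  exact huniq a _ _ (Nat.sInf_mem (hex' a))

end Computability

/-! ### The digits and stages of the construction -/

section Construction

theorem preimageCell_id {k j : ℕ} (h : j < k) :
    preimageCell (fun x => x) k j = Ico ((j : ℝ) / k) (((j : ℝ) + 1) / k) := by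
  have hk : (0 : ℝ) < k := by exact_mod_cast (Nat.zero_le j).trans_lt h
  ext x
  simp only [preimageCell, mem_ofPred_eq, and_iff_right_iff_imp]
  rintro ⟨h1, h2⟩
  refine ⟨(by positivity : (0 : ℝ) ≤ j / k).trans h1, h2.le.trans ?_⟩
  rw [div_le_one hk]
  exact_mod_cast h

theorem Delta_id {k : ℕ} (hk : 1 ≤ k) : Delta (fun x => x) k = 1 / k := by
  have : Nonempty (Fin k) := ⟨⟨0, hk⟩⟩
  have hk' : (0 : ℝ) < k := by exact_mod_cast hk
  have hvol : ∀ j : Fin k,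
      (MeasureTheory.volume (preimageCell (fun x => x) k j)).toReal = 1 / k := by
    intro j
    rw [preimageCell_id j.2, Real.volume_Ico, ← sub_div, add_sub_cancel_left,
      ENNReal.toReal_ofReal (by positivity)]
  simp only [Delta, hvol, ciInf_const]

/-- The digit `⌈q c / i⌉` as a natural number. -/
noncomputable def digit (q ν : ℕ → ℕ) (n : ℕ) : ℕ := (q n * cell ν n + (stage ν n - 1)) / stage ν n

theorem natCeil_div_eq {a i : ℕ} (hi : 1 ≤ i) :
    ⌈(a : ℝ) / i⌉ = (((a + (i - 1)) / i : ℕ) : ℤ) := by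
  have hi' : (0 : ℝ) < i := by exact_mod_cast hi
  set m := (a + (i - 1)) / i with hm
  have hdm := Nat.div_add_mod (a + (i - 1)) i
  have hlt := Nat.mod_lt (a + (i - 1)) hi
  rw [← hm] at hdm
  rw [Int.ceil_eq_iff]
  push_cast
  have h1 : a ≤ m * i := by rw [mul_comm]; omega
  have h2 : i * m < a + i := by omega
  have h1' : (a : ℝ) ≤ m * i := by exact_mod_cast h1
  have h2' : (i : ℝ) * m < a + i := by exact_mod_cast h2
  constructor
  · rw [lt_div_iff₀ hi']; linarith
  · rwa [div_le_iff₀ hi']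

/-- The cell is closed on the left, so the infimum is attained at its left endpoint. -/
theorem alpha_id {q ν : ℕ → ℕ} {n : ℕ} (hi : 1 ≤ stage ν n) :
    alpha q (fun x => x) ν n = ⌈((q n * cell ν n : ℕ) : ℝ) / stage ν n⌉ := by
  have hc : cell ν n < stage ν n := Nat.mod_lt _ hi
  have hi' : (0 : ℝ) < stage ν n := by exact_mod_cast hi
  rw [alpha, preimageCell_id hc]
  congr 1
  have hmem : ((cell ν n : ℝ) / stage ν n) ∈
      Ico ((cell ν n : ℝ) / stage ν n) (((cell ν n : ℝ) + 1) / stage ν n) :=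
    ⟨le_rfl, by gcongr; linarith⟩
  have hleast : IsLeast ((fun x : ℝ => (q n : ℝ) * x) ''
      Ico ((cell ν n : ℝ) / stage ν n) (((cell ν n : ℝ) + 1) / stage ν n))
      ((q n : ℝ) * ((cell ν n : ℝ) / stage ν n)) := by
    refine ⟨⟨_, hmem, rfl⟩, ?_⟩
    rintro _ ⟨y, hy, rfl⟩
    exact mul_le_mul_of_nonneg_left hy.1 (Nat.cast_nonneg _)
  rw [hleast.csInf_eq]
  push_cast
  ring

theorem alpha_id_eq_digit {q ν : ℕ → ℕ} {n : ℕ} (hi : 1 ≤ stage ν n) :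
    alpha q (fun x => x) ν n = digit q ν n := by
  rw [alpha_id hi, natCeil_div_eq hi, digit]

theorem one_le_ell {ν : ℕ → ℕ} {j p : ℕ} (hj : 1 ≤ j) : 1 ≤ ell ν j p := by
  unfold ell
  split_ifs
  · exact le_max_right _ _
  · exact (Nat.one_le_pow _ _ hj).trans (le_max_right _ _)

theorem sq_le_ell {ν : ℕ → ℕ} {j p : ℕ} (hj : 2 ≤ j) : j ^ 2 ≤ ell ν j p := by
  unfold ell
  rw [if_neg (by omega)]
  exact le_max_right _ _

theorem exists_le_add_mul (ν : ℕ → ℕ) {j : ℕ} (p : ℕ) (hj : 1 ≤ j) :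
    ∃ t, ν j - 1 ≤ p + j ! * j * t :=
  ⟨ν j - 1, le_add_left (Nat.le_mul_of_pos_left _ (Nat.mul_pos (Nat.factorial_pos _) hj))⟩

theorem bigL_succ (ν : ℕ → ℕ) (j : ℕ) :
    bigL ν (j + 1) = bigL ν j + (j + 1)! * (j + 1) * ell ν (j + 1) (bigL ν j) := rfl

theorem bigL_lt_succ (ν : ℕ → ℕ) (j : ℕ) : bigL ν j < bigL ν (j + 1) := by
  rw [bigL_succ]
  exact Nat.lt_add_of_pos_right
    (Nat.mul_pos (Nat.mul_pos (Nat.factorial_pos _) j.succ_pos) (one_le_ell (by omega)))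

theorem strictMono_bigL (ν : ℕ → ℕ) : StrictMono (bigL ν) :=
  strictMono_nat_of_lt_succ (bigL_lt_succ ν)

/-- Ensures that every index of a stage after `j` is at least `ν j`. The case `j = 1` is left out
because `l_1` is defined through `ν 2`. -/
theorem le_bigL (ν : ℕ → ℕ) {j : ℕ} (hj : 2 ≤ j) : ν j - 1 ≤ bigL ν j := by
  obtain ⟨i, rfl⟩ : ∃ i, j = i + 1 := ⟨j - 1, by omega⟩
  rw [bigL_succ]
  have h : ν (i + 1) - 1 ≤ bigL ν i + (i + 1)! * (i + 1) *
      sInf {t | ν (i + 1) - 1 ≤ bigL ν i + (i + 1)! * (i + 1) * t} :=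
    Nat.sInf_mem (exists_le_add_mul ν (bigL ν i) (j := i + 1) (by omega))
  refine h.trans ?_
  gcongr
  rw [ell, if_neg (by omega)]
  exact le_max_left _ _

/-- Comes from `l_j ≥ j ^ 2`; it makes one period of stage `j + 1`, of length `(j + 1)! (j + 1)`,
small compared with `L_j`. -/
theorem factorial_mul_pow_le_bigL (ν : ℕ → ℕ) {j : ℕ} (hj : 2 ≤ j) :
    j ! * j ^ 3 ≤ bigL ν j := by
  obtain ⟨i, rfl⟩ : ∃ i, j = i + 1 := ⟨j - 1, by omega⟩
  rw [bigL_succ]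
  calc (i + 1)! * (i + 1) ^ 3 = (i + 1)! * (i + 1) * (i + 1) ^ 2 := by ring
    _ ≤ (i + 1)! * (i + 1) * ell ν (i + 1) (bigL ν i) := by
      gcongr; exact sq_le_ell hj
    _ ≤ _ := Nat.le_add_left _ _

theorem stage_eq {ν : ℕ → ℕ} {j n : ℕ} (h1 : bigL ν j ≤ n) (h2 : n < bigL ν (j + 1)) :
    stage ν (n + 1) = j + 1 := by
  refine le_antisymm (Nat.sInf_le h2) ?_
  refine le_csInf ⟨j + 1, h2⟩ fun b hb => ?_
  exact (strictMono_bigL ν).lt_iff_lt.1 (lt_of_le_of_lt h1 hb)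

theorem cell_eq {ν : ℕ → ℕ} {j n : ℕ} (h1 : bigL ν j ≤ n) (h2 : n < bigL ν (j + 1)) :
    cell ν (n + 1) = (n - bigL ν j) / (j + 1)! % (j + 1) := by
  rw [cell, stage_eq h1 h2]
  congr 2
  simp only [Nat.add_sub_cancel]
  omega

theorem exists_bigL_le_lt (ν : ℕ → ℕ) (n : ℕ) : ∃ j, bigL ν j ≤ n ∧ n < bigL ν (j + 1) := by
  have hex : ∃ i, n < bigL ν i := ⟨n + 1, (strictMono_bigL ν).le_apply.trans_lt' n.lt_succ_self⟩
  classical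
  have h0 : Nat.find hex ≠ 0 := fun h => by
    have := Nat.find_spec hex
    rw [h] at this
    exact absurd this (Nat.not_lt_zero _)
  refine ⟨Nat.find hex - 1, ?_, ?_⟩
  · exact not_lt.1 (Nat.find_min hex (by omega))
  · rw [Nat.sub_add_cancel (by omega)]
    exact Nat.find_spec hex

theorem one_le_stage (ν : ℕ → ℕ) (n : ℕ) : 1 ≤ stage ν (n + 1) := by
  obtain ⟨j, h1, h2⟩ := exists_bigL_le_lt ν n
  rw [stage_eq h1 h2]
  omega

theorem digit_le (q ν : ℕ → ℕ) (n : ℕ) : digit q ν (n + 1) ≤ q (n + 1) := by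
  have hi := one_le_stage ν n
  have hc : cell ν (n + 1) < stage ν (n + 1) := Nat.mod_lt _ hi
  rw [digit]
  refine Nat.lt_succ_iff.1 ((Nat.div_lt_iff_lt_mul hi).2 ?_)
  have : q (n + 1) * cell ν (n + 1) ≤ q (n + 1) * stage ν (n + 1) := by gcongr
  rw [Nat.succ_mul]
  omega

end Construction

/-! ### The least choice of `ν` in terms of integer thresholds -/

section Threshold

/-- The threshold `(4 j) ^ log (4 j)`. -/
noncomputable def threshold (j : ℕ) : ℝ := Real.exp (Real.log (4 * j) ^ 2)

variable {q : ℕ → ℕ}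

theorem prodTo_succ (q : ℕ → ℕ) (n : ℕ) : prodTo q (n + 1) = prodTo q n * q (n + 1) :=
  Finset.prod_Icc_succ_top (by omega) _

theorem two_pow_le_prodTo (hq : IsBasic q) (n : ℕ) : 2 ^ n ≤ prodTo q n := by
  induction n with
  | zero => simp [prodTo]
  | succ n ih =>
    rw [prodTo_succ, pow_succ]
    exact Nat.mul_le_mul ih (hq _ (by omega))

theorem prodTo_pos (hq : IsBasic q) (n : ℕ) : 0 < prodTo q n :=
  (by positivity : 0 < 2 ^ n).trans_le (two_pow_le_prodTo hq n)

theorem monotone_prodTo (hq : IsBasic q) : Monotone (prodTo q) :=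
  monotone_nat_of_le_succ fun n => by
    rw [prodTo_succ]
    exact Nat.le_mul_of_pos_right _ (by have := hq (n + 1) (by omega); omega)

/-- Square and exponentiate; since `m` is an integer, the real threshold may be replaced by its
ceiling. -/
theorem le_sqrt_log_iff {j m : ℕ} (hj : 1 ≤ j) (hm : 1 ≤ m) :
    Real.log (4 * j) ≤ √(Real.log m) ↔ ⌈threshold j⌉₊ ≤ m := by
  have hj' : (1 : ℝ) ≤ j := by exact_mod_cast hj
  have hm' : (0 : ℝ) < m := by exact_mod_cast hm
  rw [Real.le_sqrt (Real.log_nonneg (by linarith)) (Real.log_natCast_nonneg m),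
    Real.le_log_iff_exp_le hm', Nat.ceil_le,
    threshold]

theorem nu_eq_sInf (hq : IsBasic q) {j : ℕ} (hj : 1 ≤ j) :
    nu q (fun x => x) j =
      sInf {t | 1 ≤ t ∧ ∀ k, t ≤ k → ⌈threshold j⌉₊ ≤ q k ∧ ⌈threshold j⌉₊ ≤ prodTo q (k - 1)} := by
  have hj' : (0 : ℝ) < j := by exact_mod_cast hj
  rw [nu, Delta_id hj, one_div, Real.log_inv, sub_neg_eq_add, ← Real.log_mul (by norm_num) hj'.ne']
  congr 1
  ext t
  simp only [mem_ofPred_eq]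
  refine and_congr_right fun ht => forall_congr' fun k => imp_congr_right fun hk => ?_
  have hqk := hq k (by omega)
  rw [le_min_iff, le_sqrt_log_iff hj (by omega), le_sqrt_log_iff hj (prodTo_pos hq _)]

/-- The least index from which on all terms and all products of previous terms are at least `N`. -/
noncomputable def growthIndex (q : ℕ → ℕ) (N : ℕ) : ℕ :=
  max (sInf {i : ℕ | 1 ≤ i ∧ ∀ j, i ≤ j → N ≤ q j}) (sInf {t | 1 ≤ t ∧ N ≤ prodTo q (t - 1)})

theorem exists_forall_le (hlim : Tendsto q atTop atTop) (N : ℕ) :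
    ∃ i, 1 ≤ i ∧ ∀ j, i ≤ j → N ≤ q j := by
  obtain ⟨i, hi⟩ := eventually_atTop.1 (hlim.eventually_ge_atTop N)
  exact ⟨max i 1, le_max_right _ _, fun j hj => hi j (le_of_max_le_left hj)⟩

theorem exists_le_prodTo (hq : IsBasic q) (N : ℕ) : ∃ t, 1 ≤ t ∧ N ≤ prodTo q (t - 1) :=
  ⟨N + 1, by omega, Nat.lt_two_pow_self.le.trans (two_pow_le_prodTo hq N)⟩

/-- The products increase, so their bound need only be checked at `k = t`; `q` need not be monotone,
so its bound has to be asked of all later terms. -/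
theorem isLeast_growthIndex (hq : IsBasic q) (hlim : Tendsto q atTop atTop) (N : ℕ) :
    IsLeast {t | 1 ≤ t ∧ ∀ k, t ≤ k → N ≤ q k ∧ N ≤ prodTo q (k - 1)} (growthIndex q N) := by
  have h1 := Nat.sInf_mem (exists_forall_le hlim N)
  have h2 := Nat.sInf_mem (exists_le_prodTo hq N)
  refine ⟨⟨h1.1.trans (le_max_left _ _), fun k hk => ⟨h1.2 k (le_of_max_le_left hk), ?_⟩⟩, ?_⟩
  · exact h2.2.trans (monotone_prodTo hq (Nat.sub_le_sub_right (le_of_max_le_right hk) 1))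
  · rintro t ⟨ht, h⟩
    exact max_le (Nat.sInf_le ⟨ht, fun j hj => (h j hj).1⟩) (Nat.sInf_le ⟨ht, (h t le_rfl).2⟩)

theorem nu_eq_growthIndex (hq : IsBasic q) (hlim : Tendsto q atTop atTop) {j : ℕ} (hj : 1 ≤ j) :
    nu q (fun x => x) j = growthIndex q ⌈threshold j⌉₊ := by
  rw [nu_eq_sInf hq hj]
  exact (isLeast_growthIndex hq hlim _).csInf_eq

theorem threshold_le_of_nu_le (hq : IsBasic q) (hlim : Tendsto q atTop atTop) {j k : ℕ}
    (hj : 1 ≤ j) (hk : nu q (fun x => x) j ≤ k) : threshold j ≤ q k := by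
  rw [nu_eq_growthIndex hq hlim hj] at hk
  exact Nat.ceil_le.1 ((isLeast_growthIndex hq hlim _).1.2 k hk).1

theorem sq_le_threshold {j : ℕ} (hj : 2 ≤ j) : (4 * (j : ℝ)) ^ 2 ≤ threshold j := by
  have hj' : (2 : ℝ) ≤ j := by exact_mod_cast hj
  have hpos : (0 : ℝ) < 4 * j := by positivity
  -- This is where `j ≥ 2` enters: `e ^ 2 < 8 ≤ 4 j`.
  have h2 : 2 ≤ Real.log (4 * j) := by
    rw [Real.le_log_iff_exp_le hpos]
    calc Real.exp 2 = Real.exp 1 ^ 2 := by rw [← Real.exp_nat_mul]; norm_num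
      _ ≤ 2.7182818286 ^ 2 := by gcongr; exact Real.exp_one_lt_d9.le
      _ ≤ 8 := by norm_num
      _ ≤ 4 * j := by linarith
  rw [threshold, ← Real.exp_log (pow_pos hpos 2), Real.log_pow]
  gcongr
  push_cast
  nlinarith

theorem threshold_le_pow {j : ℕ} (hj : 1 ≤ j) : threshold j ≤ ((4 * j) ^ (4 * j) : ℕ) := by
  have hj' : (1 : ℝ) ≤ j := by exact_mod_cast hj
  have hpos : (0 : ℝ) < 4 * j := by positivity
  have h0 : 0 ≤ Real.log (4 * j) := Real.log_nonneg (by linarith)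
  have h1 : Real.log (4 * j) ≤ 4 * j := (Real.log_le_sub_one_of_pos hpos).trans (by linarith)
  push_cast
  rw [threshold, ← Real.exp_log (pow_pos hpos (4 * j)), Real.log_pow]
  gcongr
  push_cast
  nlinarith

end Threshold

/-! ### Cantor series: truncation errors and location of the orbit -/

section Series

variable {q : ℕ → ℕ} {a : ℕ → ℕ}

/-- Numerators of the partial sums of `∑ a n / (q₁ ⋯ qₙ₊₁)` over the denominators `q₁ ⋯ qₙ`. -/
def numerator (q a : ℕ → ℕ) : ℕ → ℕ
  | 0 => 0
  | n + 1 => numerator q a n * q (n + 1) + a n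

theorem sum_range_eq_numerator_div (hq : IsBasic q) (n : ℕ) :
    ∑ m ∈ Finset.range n, (a m : ℝ) / prodTo q (m + 1) = numerator q a n / prodTo q n := by
  induction n with
  | zero => simp [numerator]
  | succ n ih =>
    have h1 : (prodTo q n : ℝ) ≠ 0 := by exact_mod_cast (prodTo_pos hq n).ne'
    have h2 : (q (n + 1) : ℝ) ≠ 0 := by
      have := hq (n + 1) (by omega)
      exact_mod_cast (by omega : q (n + 1) ≠ 0)
    rw [Finset.sum_range_succ, ih, numerator, prodTo_succ]
    push_cast
    field_simp

theorem term_le_inv_prodTo (hq : IsBasic q) (ha : ∀ n, a n ≤ q (n + 1)) (n : ℕ) :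
    (a n : ℝ) / prodTo q (n + 1) ≤ 1 / prodTo q n := by
  have h1 : (0 : ℝ) < prodTo q n := by exact_mod_cast prodTo_pos hq n
  have h2 : (0 : ℝ) < prodTo q (n + 1) := by exact_mod_cast prodTo_pos hq (n + 1)
  rw [div_le_div_iff₀ h2 h1, one_mul, prodTo_succ]
  push_cast
  rw [mul_comm]
  gcongr
  exact_mod_cast ha n

theorem inv_prodTo_add_le (hq : IsBasic q) (n m : ℕ) :
    1 / (prodTo q (m + n) : ℝ) ≤ 1 / prodTo q n * (1 / 2) ^ m := by
  have h1 : (0 : ℝ) < prodTo q n := by exact_mod_cast prodTo_pos hq n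
  have h : prodTo q n * 2 ^ m ≤ prodTo q (m + n) := by
    induction m with
    | zero => simp
    | succ m ih =>
      rw [Nat.add_right_comm, prodTo_succ, pow_succ, ← mul_assoc]
      exact Nat.mul_le_mul ih (hq _ (by omega))
  rw [one_div_pow, one_div_mul_one_div]
  exact one_div_le_one_div_of_le (by positivity) (by exact_mod_cast h)

theorem summable_term (hq : IsBasic q) (ha : ∀ n, a n ≤ q (n + 1)) :
    Summable fun n => (a n : ℝ) / prodTo q (n + 1) := by
  refine Summable.of_nonneg_of_le (fun n => by positivity) (fun n => ?_)
    (summable_geometric_two.mul_left (1 / (prodTo q 0 : ℝ)))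
  exact (term_le_inv_prodTo hq ha n).trans (inv_prodTo_add_le hq 0 n)

/-- A digit may equal `q (n + 1)`, so the tail is compared with the geometric series `1 + 1/2 + 1/4
+ ⋯`, which gives the constant `2`. -/
theorem tsum_term_bounds (hq : IsBasic q) (ha : ∀ n, a n ≤ q (n + 1)) (n : ℕ) :
    (numerator q a n : ℝ) ≤ prodTo q n * ∑' m, (a m : ℝ) / prodTo q (m + 1) ∧
      prodTo q n * ∑' m, (a m : ℝ) / prodTo q (m + 1) ≤ numerator q a n + 2 := by
  have h1 : (0 : ℝ) < prodTo q n := by exact_mod_cast prodTo_pos hq n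
  have hs := summable_term hq ha
  have hsplit := hs.sum_add_tsum_nat_add n
  rw [sum_range_eq_numerator_div hq] at hsplit
  have h0 : 0 ≤ ∑' m, (a (m + n) : ℝ) / prodTo q (m + n + 1) :=
    tsum_nonneg fun m => by positivity
  have h2 : ∑' m, (a (m + n) : ℝ) / prodTo q (m + n + 1) ≤ 1 / prodTo q n * 2 := by
    rw [← tsum_geometric_two, ← tsum_mul_left]
    refine Summable.tsum_le_tsum (fun m => ?_) ((summable_nat_add_iff n).2 hs)
      (summable_geometric_two.mul_left _)
    exact (term_le_inv_prodTo hq ha (m + n)).trans (inv_prodTo_add_le hq n m)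
  rw [← hsplit, mul_add, mul_div_cancel₀ _ h1.ne']
  have h3 := mul_le_mul_of_nonneg_left h2 h1.le
  rw [← mul_assoc, mul_one_div_cancel h1.ne', one_mul] at h3
  exact ⟨by linarith [mul_nonneg h1.le h0], by linarith⟩

/-- One step of the Cantor expansion: `q₁ ⋯ qₙ x` lies within `2 / qₙ₊₁` above
`Aₙ + aₙ / qₙ₊₁`. -/
theorem prodTo_mul_tsum_bounds (hq : IsBasic q) (ha : ∀ n, a n ≤ q (n + 1)) (n : ℕ) :
    numerator q a n + (a n : ℝ) / q (n + 1) ≤ prodTo q n * ∑' m, (a m : ℝ) / prodTo q (m + 1) ∧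
      prodTo q n * ∑' m, (a m : ℝ) / prodTo q (m + 1) ≤
        numerator q a n + ((a n : ℝ) + 2) / q (n + 1) := by
  have hqn : (0 : ℝ) < q (n + 1) := by
    have := hq (n + 1) (by omega)
    exact_mod_cast (by omega : 0 < q (n + 1))
  have h := tsum_term_bounds hq ha (n + 1)
  set x := ∑' m, (a m : ℝ) / prodTo q (m + 1)
  rw [prodTo_succ, numerator] at h
  push_cast at h
  have e : (prodTo q n : ℝ) * x = (prodTo q n * q (n + 1) * x) / q (n + 1) := by
    field_simp
  rw [e]
  constructor
  · rw [le_div_iff₀ hqn, add_mul, div_mul_cancel₀ _ hqn.ne']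
    exact h.1
  · rw [div_le_iff₀ hqn, add_mul, div_mul_cancel₀ _ hqn.ne']
    linarith [h.2]

variable {ν : ℕ → ℕ}

theorem xi_eq_tsum_digit (q ν : ℕ → ℕ) :
    xi q (fun x => x) ν = ∑' n, (digit q ν (n + 1) : ℝ) / prodTo q (n + 1) := by
  simp only [xi, alpha_id_eq_digit (one_le_stage ν _), Int.cast_natCast]

theorem summable_alpha_div (hq : IsBasic q) (ν : ℕ → ℕ) :
    Summable fun n => (alpha q (fun x => x) ν (n + 1) : ℝ) / (prodTo q (n + 1) : ℝ) := by
  simp only [alpha_id_eq_digit (one_le_stage ν _), Int.cast_natCast]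
  exact summable_term (a := fun n => digit q ν (n + 1)) hq (digit_le q ν)

/-- Once `qₙ₊₁` is large compared with the stage, `T_{Q,n}(ξ)` lies in the prescribed cell. -/
theorem T_xi_mem_Ico (hq : IsBasic q) {n : ℕ} (hbig : 3 * stage ν (n + 1) ≤ q (n + 1)) :
    T q (xi q (fun x => x) ν) n ∈ Ico ((cell ν (n + 1) : ℝ) / stage ν (n + 1))
      (((cell ν (n + 1) : ℝ) + 1) / stage ν (n + 1)) := by
  have h := prodTo_mul_tsum_bounds (a := fun n => digit q ν (n + 1)) hq (digit_le q ν) n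
  rw [← xi_eq_tsum_digit] at h
  set A := numerator q (fun n => digit q ν (n + 1)) n
  set x := (prodTo q n : ℝ) * xi q (fun x => x) ν with hx
  have hi := one_le_stage ν n
  have hc : cell ν (n + 1) < stage ν (n + 1) := Nat.mod_lt _ hi
  have hceil := alpha_id (q := q) hi
  rw [alpha_id_eq_digit hi] at hceil
  have hd := Int.ceil_eq_iff.1 hceil.symm
  set i := stage ν (n + 1)
  set c := cell ν (n + 1)
  set d := digit q ν (n + 1)
  have hi' : (0 : ℝ) < i := by exact_mod_cast hi
  have hqi : (3 * i : ℝ) ≤ q (n + 1) := by exact_mod_cast hbig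
  have hqn : (0 : ℝ) < q (n + 1) := by linarith
  have hc' : (c : ℝ) + 1 ≤ i := by exact_mod_cast hc
  push_cast at hd
  have hlow : (c : ℝ) / i ≤ x - A := by
    refine le_trans ?_ (le_sub_iff_add_le'.2 h.1)
    rw [le_div_iff₀ hqn]
    calc (c : ℝ) / i * q (n + 1) = q (n + 1) * c / i := by ring
      _ ≤ d := hd.2
  have hupp : x - A < ((c : ℝ) + 1) / i := by
    refine (sub_le_iff_le_add'.2 h.2).trans_lt ?_
    rw [div_lt_iff₀ hqn]
    -- The `3` pays for the ceiling (less than `1`) and for the tail (at most `2`).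
    have h3 : (3 : ℝ) ≤ q (n + 1) / i := by rwa [le_div_iff₀ hi']
    calc (d : ℝ) + 2 < q (n + 1) * c / i + 3 := by linarith [hd.1]
      _ ≤ q (n + 1) * c / i + q (n + 1) / i := by gcongr
      _ = ((c : ℝ) + 1) / i * q (n + 1) := by ring
  have hfl : ⌊x⌋ = A := by
    rw [Int.floor_eq_iff]
    have h0 : (0 : ℝ) ≤ c / i := by positivity
    have h1 : ((c : ℝ) + 1) / i ≤ 1 := (div_le_one hi').2 hc'
    push_cast
    exact ⟨by linarith, by linarith⟩
  have hT : T q (xi q (fun x => x) ν) n = x - A := by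
    rw [T, ← hx, ← Int.self_sub_floor, hfl]
    simp
  rw [hT]
  exact ⟨hlow, hupp⟩

theorem T_xi_mem_Ico_of_bigL (hq : IsBasic q) (hlim : Tendsto q atTop atTop)
    (hν : ∀ j, 1 ≤ j → nu q (fun x => x) j ≤ ν j) {j m : ℕ} (hj : 2 ≤ j)
    (hm : m < (j + 1)! * (j + 1) * ell ν (j + 1) (bigL ν j)) :
    T q (xi q (fun x => x) ν) (bigL ν j + m) ∈ Ico (((m / (j + 1)! % (j + 1) : ℕ) : ℝ) / (j + 1 : ℕ))
      ((((m / (j + 1)! % (j + 1) : ℕ) : ℝ) + 1) / (j + 1 : ℕ)) := by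
  have h1 : bigL ν j ≤ bigL ν j + m := Nat.le_add_right _ _
  have h2 : bigL ν j + m < bigL ν (j + 1) := by rw [bigL_succ]; omega
  have hs := stage_eq h1 h2
  have hc := cell_eq h1 h2
  rw [Nat.add_sub_cancel_left] at hc
  have hbig : 3 * stage ν (bigL ν j + m + 1) ≤ q (bigL ν j + m + 1) := by
    rw [hs]
    -- Stage `j + 1` is governed by `ν j`, not by `ν (j + 1)`. The resulting bound `16 j ^ 2`
    -- exceeds `3 (j + 1)`.
    have hk : nu q (fun x => x) j ≤ bigL ν j + m + 1 := by
      have := hν j (by omega)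
      have := le_bigL ν hj
      omega
    have ht := (sq_le_threshold hj).trans (threshold_le_of_nu_le hq hlim (by omega) hk)
    have ht' : (4 * j) ^ 2 ≤ q (bigL ν j + m + 1) := by exact_mod_cast ht
    nlinarith
  have := T_xi_mem_Ico hq hbig
  rwa [hs, hc] at this

end Series

/-! ### Counting errors over periodic blocks -/

section Discrepancy

theorem sum_range_mul_div (D K : ℕ) (h : ℕ → ℝ) :
    ∑ m ∈ Finset.range (D * K), h (m / D) = D * ∑ c ∈ Finset.range K, h c := by
  rcases D.eq_zero_or_pos with rfl | hD
  · simp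
  induction K with
  | zero => simp
  | succ K ih =>
    rw [Nat.mul_succ, Finset.sum_range_add, ih, Finset.sum_range_succ, mul_add]
    congr 1
    rw [Finset.sum_congr rfl (g := fun _ => h K), Finset.sum_const, Finset.card_range,
      nsmul_eq_mul]
    intro x hx
    rw [Nat.mul_add_div hD, Nat.div_eq_of_lt (Finset.mem_range.1 hx), add_zero]

theorem sum_range_mul_div_mod (D K b : ℕ) (h : ℕ → ℝ) :
    ∑ m ∈ Finset.range (D * K * b), h (m / D % K) = b * (D * ∑ c ∈ Finset.range K, h c) := by
  rcases D.eq_zero_or_pos with rfl | hD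
  · simp
  induction b with
  | zero => simp
  | succ b ih =>
    rw [Nat.mul_succ, Finset.sum_range_add, ih, ← sum_range_mul_div]
    push_cast
    rw [add_mul, one_mul]
    congr 1
    refine Finset.sum_congr rfl fun m hm => ?_
    rw [mul_assoc, Nat.mul_add_div hD, Nat.mul_add_mod,
      Nat.mod_eq_of_lt (Nat.div_lt_of_lt_mul (Finset.mem_range.1 hm))]

/-- The indicator of `[0, x)` evaluated along `ω`, minus `x`. -/
noncomputable def deviation (ω : ℕ → ℝ) (x : ℝ) (n : ℕ) : ℝ :=
  (if ω n ∈ Ico 0 x then 1 else 0) - x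

theorem abs_deviation_le {x : ℝ} (hx : x ∈ Icc (0 : ℝ) 1) (ω : ℕ → ℝ) (n : ℕ) :
    |deviation ω x n| ≤ 1 := by
  rw [deviation, abs_le]
  obtain ⟨h0, h1⟩ := hx
  split_ifs <;> constructor <;> linarith

/-- With `y = x K`, the first sum counts cells contained in `[0, x)` and the second those meeting
it; they are compared with `⌊y⌋` and `⌈y⌉`. -/
theorem sum_card_le {K : ℕ} {y : ℝ} (hy0 : 0 ≤ y) (hyK : y ≤ K) :
    y - 1 ≤ ∑ c ∈ Finset.range K, (if (c : ℝ) + 1 ≤ y then (1 : ℝ) else 0) ∧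
      ∑ c ∈ Finset.range K, (if (c : ℝ) < y then (1 : ℝ) else 0) ≤ y + 1 := by
  rw [Finset.sum_boole, Finset.sum_boole]
  constructor
  · have hsub : Finset.range ⌊y⌋₊ ⊆ {c ∈ Finset.range K | ((c : ℕ) : ℝ) + 1 ≤ y} := by
      intro c hc
      have hc' : c + 1 ≤ ⌊y⌋₊ := Finset.mem_range.1 hc
      have h2 := (Nat.le_floor_iff hy0).1 hc'
      push_cast at h2
      refine Finset.mem_filter.2 ⟨Finset.mem_range.2 ?_, h2⟩
      have : (c : ℝ) + 1 ≤ K := h2.trans hyK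
      exact_mod_cast this
    have h3 := Finset.card_le_card hsub
    rw [Finset.card_range] at h3
    have h4 : (⌊y⌋₊ : ℝ) ≤ _ := Nat.cast_le.2 h3
    linarith [Nat.sub_one_lt_floor y]
  · have hsub : {c ∈ Finset.range K | ((c : ℕ) : ℝ) < y} ⊆ Finset.range ⌈y⌉₊ := by
      intro c hc
      exact Finset.mem_range.2 (Nat.lt_ceil.2 (Finset.mem_filter.1 hc).2)
    have h3 := Finset.card_le_card hsub
    rw [Finset.card_range] at h3
    have h4 : _ ≤ (⌈y⌉₊ : ℝ) := Nat.cast_le.2 h3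
    linarith [Nat.ceil_lt_add_one hy0]

/-- Over `b` full periods of a sequence running through the cells `[c/K, (c+1)/K)`, spending `D`
terms in each, the deviation is at most `D b`. -/
theorem abs_sum_deviation_le {ω : ℕ → ℝ} {x : ℝ} (hx : x ∈ Icc (0 : ℝ) 1) {L D K b : ℕ}
    (hK : 0 < K)
    (h : ∀ m < D * K * b, ω (L + m) ∈ Ico (((m / D % K : ℕ) : ℝ) / K)
      ((((m / D % K : ℕ) : ℝ) + 1) / K)) :
    |∑ m ∈ Finset.range (D * K * b), deviation ω x (L + m)| ≤ b * D := by
  have hK' : (0 : ℝ) < K := by exact_mod_cast hK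
  obtain ⟨hx0, hx1⟩ := hx
  obtain ⟨hlow, hupp⟩ := sum_card_le (K := K) (y := x * K) (by positivity)
    (mul_le_of_le_one_left hK'.le hx1)
  have e : ∑ m ∈ Finset.range (D * K * b), deviation ω x (L + m) =
      ∑ m ∈ Finset.range (D * K * b), (if ω (L + m) ∈ Ico 0 x then (1 : ℝ) else 0)
        - D * K * b * x := by
    simp [deviation, Finset.sum_sub_distrib]
  have h1 : (b : ℝ) * (D * ∑ c ∈ Finset.range K, (if (c : ℝ) + 1 ≤ x * K then (1 : ℝ) else 0)) ≤
      ∑ m ∈ Finset.range (D * K * b), (if ω (L + m) ∈ Ico 0 x then (1 : ℝ) else 0) := by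
    rw [← sum_range_mul_div_mod D K b (fun c => if (c : ℝ) + 1 ≤ x * K then (1 : ℝ) else 0)]
    refine Finset.sum_le_sum fun m hm => ?_
    obtain ⟨ha, hb⟩ := h m (Finset.mem_range.1 hm)
    by_cases hc : ((m / D % K : ℕ) : ℝ) + 1 ≤ x * K
    · have hmem : ω (L + m) ∈ Ico 0 x :=
        ⟨le_trans (by positivity) ha, hb.trans_le ((div_le_iff₀ hK').2 hc)⟩
      rw [if_pos hc, if_pos hmem]
    · rw [if_neg hc]
      split_ifs <;> norm_num
  have h2 : ∑ m ∈ Finset.range (D * K * b), (if ω (L + m) ∈ Ico 0 x then (1 : ℝ) else 0) ≤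
      b * (D * ∑ c ∈ Finset.range K, (if (c : ℝ) < x * K then (1 : ℝ) else 0)) := by
    rw [← sum_range_mul_div_mod D K b (fun c => if (c : ℝ) < x * K then (1 : ℝ) else 0)]
    refine Finset.sum_le_sum fun m hm => ?_
    obtain ⟨ha, hb⟩ := h m (Finset.mem_range.1 hm)
    by_cases hc : ((m / D % K : ℕ) : ℝ) < x * K
    · rw [if_pos hc]
      split_ifs <;> norm_num
    · have hmem : ω (L + m) ∉ Ico 0 x := fun hmem =>
        hc ((div_lt_iff₀ hK').1 (ha.trans_lt hmem.2))
      rw [if_neg hc, if_neg hmem]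
  have hbD : (0 : ℝ) ≤ b * D := by positivity
  rw [e, abs_le]
  constructor
  · nlinarith [mul_le_mul_of_nonneg_left hlow hbD]
  · nlinarith [mul_le_mul_of_nonneg_left hupp hbD]

theorem abs_sum_deviation_le_length {ω : ℕ → ℝ} {x : ℝ} (hx : x ∈ Icc (0 : ℝ) 1) (L n : ℕ) :
    |∑ m ∈ Finset.range n, deviation ω x (L + m)| ≤ n := by
  refine (Finset.abs_sum_le_sum_abs _ _).trans ?_
  refine (Finset.sum_le_sum fun m _ => abs_deviation_le hx ω (L + m)).trans ?_
  simp

theorem hasADF_id_of_deviation {ω : ℕ → ℝ}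
    (h : ∀ x ∈ Icc (0 : ℝ) 1,
      Tendsto (fun n : ℕ => (∑ m ∈ Finset.range n, deviation ω x m) / n) atTop (𝓝 0)) :
    HasADF ω (fun t => t) := by
  intro x hx
  have h1 := (h x hx).add_const x
  rw [zero_add] at h1
  refine h1.congr' ?_
  filter_upwards [eventually_gt_atTop 0] with n hn
  have hn' : (n : ℝ) ≠ 0 := by exact_mod_cast hn.ne'
  have e : ∑ m ∈ Finset.range n, deviation ω x m =
      (((Finset.range n).filter (fun i => ω i ∈ Ico 0 x)).card : ℝ) - n * x := by
    simp only [deviation, Finset.sum_sub_distrib, Finset.sum_boole, Finset.sum_const,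
      Finset.card_range, nsmul_eq_mul]
  rw [e]
  field_simp
  ring

/-- First fix `j` with `C / j < ε / 2`, then take `n` so large that `L j / n < ε / 2`. -/
theorem tendsto_div_of_bounds {S : ℕ → ℝ} {L : ℕ → ℕ} {C : ℝ}
    (h : ∀ j, 2 ≤ j → ∀ n, L j ≤ n → |S n| ≤ L j + C * n / j) :
    Tendsto (fun n : ℕ => S n / n) atTop (𝓝 0) := by
  rw [Metric.tendsto_atTop]
  intro ε hε
  obtain ⟨j, hj⟩ := exists_nat_gt (max 2 (2 * C / ε))
  have hj2 : 2 < j := by exact_mod_cast (le_max_left _ _).trans_lt hj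
  have hjC := (le_max_right _ _).trans_lt hj
  have hj0 : (0 : ℝ) < j := by exact_mod_cast (by omega : 0 < j)
  obtain ⟨M, hM⟩ := exists_nat_gt (2 * L j / ε)
  refine ⟨max (L j) (max M 1), fun n hn => ?_⟩
  have hn1 : L j ≤ n := le_of_max_le_left hn
  have hn2 : (M : ℝ) ≤ n := by exact_mod_cast le_of_max_le_left (le_of_max_le_right hn)
  have hn3 : (0 : ℝ) < n := by
    have : 1 ≤ n := le_of_max_le_right (le_of_max_le_right hn)
    exact_mod_cast this
  rw [Real.dist_eq, sub_zero, abs_div, abs_of_pos hn3, div_lt_iff₀ hn3]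
  refine (h j hj2.le n hn1).trans_lt ?_
  have h1 : 2 * C < ε * j := by rwa [div_lt_iff₀' hε] at hjC
  have h2 : 2 * L j < ε * n := by
    have := hM.trans_le hn2
    rwa [div_lt_iff₀' hε] at this
  have h3 : C * n / j < ε / 2 * n := by
    rw [div_lt_iff₀ hj0]
    nlinarith
  linarith

end Discrepancy

/-! ### Distribution normality -/

section Normality

variable {q ν : ℕ → ℕ}

/-- The deviation within stage `j + 1`, up to index `n`. -/
theorem abs_sum_deviation_stage_le {ω : ℕ → ℝ} {x : ℝ} (hx : x ∈ Icc (0 : ℝ) 1) {L D K l r : ℕ}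
    (hD : 0 < D) (hK : 0 < K)
    (h : ∀ m < D * K * l, ω (L + m) ∈ Ico (((m / D % K : ℕ) : ℝ) / K)
      ((((m / D % K : ℕ) : ℝ) + 1) / K)) (hr : r ≤ D * K * l) :
    |∑ m ∈ Finset.range r, deviation ω x (L + m)| ≤ r / K + D * K := by
  have hK' : (0 : ℝ) < K := by exact_mod_cast hK
  have hdm := Nat.div_add_mod r (D * K)
  have hlt := Nat.mod_lt r (Nat.mul_pos hD hK)
  set b := r / (D * K) with hb
  set s := r % (D * K) with hs
  have h1 := abs_sum_deviation_le (b := b) hx hK fun m hm => h m (by omega)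
  have h2 := abs_sum_deviation_le_length (ω := ω) hx (L + D * K * b) s
  rw [← hdm, Finset.sum_range_add]
  simp only [add_assoc] at h2
  refine (abs_add_le _ _).trans (add_le_add (h1.trans ?_) (h2.trans ?_))
  · rw [le_div_iff₀ hK']
    have : b * D * K ≤ D * K * b + s := by
      rw [mul_comm (D * K), mul_assoc]; exact Nat.le_add_right _ _
    exact_mod_cast this
  · exact_mod_cast hlt.le

theorem isDistributionNormal_xi (hq : IsBasic q) (hlim : Tendsto q atTop atTop)
    (hν : ∀ j, 1 ≤ j → nu q (fun x => x) j ≤ ν j) :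
    IsDistributionNormal q (xi q (fun x => x) ν) := by
  refine hasADF_id_of_deviation fun x hx => ?_
  set ω := T q (xi q (fun x => x) ν) with hω
  set S : ℕ → ℝ := fun n => ∑ m ∈ Finset.range n, deviation ω x m with hS
  -- Of the constant `5`, one part covers the full periods and four cover the last, unfinished
  -- period.
  refine tendsto_div_of_bounds (S := S) (L := bigL ν) (C := 5) fun j₀ hj₀ n hn => ?_
  have hj₀' : (0 : ℝ) < j₀ := by exact_mod_cast (by omega : 0 < j₀)
  have hcell : ∀ j, 2 ≤ j → ∀ m < (j + 1)! * (j + 1) * ell ν (j + 1) (bigL ν j), _ :=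
    fun j hj m hm => T_xi_mem_Ico_of_bigL hq hlim hν hj hm
  have hstep : ∀ L r, S (L + r) = S L + ∑ m ∈ Finset.range r, deviation ω x (L + m) :=
    fun L r => Finset.sum_range_add _ _ _
  -- Terms before `L_{j₀}` are bounded trivially; each later stage costs its length over `j + 1 ≥
  -- j₀`, and the lengths telescope.
  have hstages : ∀ j, j₀ ≤ j → |S (bigL ν j)| ≤ bigL ν j₀ + ((bigL ν j : ℝ) - bigL ν j₀) / j₀ := by
    intro j hj
    induction j, hj using Nat.le_induction with
    | base =>
      have := abs_sum_deviation_le_length (ω := ω) hx 0 (bigL ν j₀)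
      simpa [hS] using this
    | succ j hj ih =>
      have h1 := abs_sum_deviation_le hx j.succ_pos (hcell j (by omega))
      rw [bigL_succ, hstep]
      refine (abs_add_le _ _).trans ((add_le_add ih h1).trans ?_)
      rw [add_assoc]
      gcongr
      rw [div_add' _ _ _ hj₀'.ne']
      gcongr
      push_cast
      have hjr : (j₀ : ℝ) ≤ j + 1 := by exact_mod_cast (by omega : j₀ ≤ j + 1)
      have hp : (0 : ℝ) ≤ ell ν (j + 1) (bigL ν j) * (j + 1)! := by positivity
      nlinarith [mul_le_mul_of_nonneg_left hjr hp]
  obtain ⟨j, hj1, hj2⟩ := exists_bigL_le_lt ν n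
  have hj : j₀ ≤ j := by
    by_contra hlt
    have := (strictMono_bigL ν).monotone (by omega : j + 1 ≤ j₀)
    omega
  obtain ⟨r, rfl⟩ := Nat.exists_eq_add_of_le hj1
  rw [bigL_succ] at hj2
  have h1 := abs_sum_deviation_stage_le (r := r) hx (K := j + 1) (Nat.factorial_pos (j + 1)) j.succ_pos
    (hcell j (by omega)) (by omega)
  rw [hstep]
  refine (abs_add_le _ _).trans ((add_le_add (hstages j hj) h1).trans ?_)
  have hL : (j ! * j ^ 3 : ℝ) ≤ bigL ν j := by
    exact_mod_cast factorial_mul_pow_le_bigL ν (by omega : 2 ≤ j)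
  have hjr : (j₀ : ℝ) ≤ j := by exact_mod_cast hj
  have hj2r : (2 : ℝ) ≤ j := by exact_mod_cast (by omega : 2 ≤ j)
  have hfac : (0 : ℝ) < j ! := by exact_mod_cast Nat.factorial_pos j
  have hr : (r : ℝ) / ((j + 1 : ℕ) : ℝ) ≤ r / j₀ := by
    gcongr
    omega
  have hcube : ((j : ℝ) + 1) ^ 2 * j ≤ 4 * j ^ 3 := by
    calc ((j : ℝ) + 1) ^ 2 * j ≤ (2 * (j : ℝ)) ^ 2 * j := by gcongr; linarith
      _ = 4 * (j : ℝ) ^ 3 := by ring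
  have hper : ((j + 1)! : ℝ) * ((j + 1 : ℕ) : ℝ) ≤ 4 * bigL ν j / j₀ := by
    rw [le_div_iff₀ hj₀', Nat.factorial_succ]
    push_cast
    calc ((j : ℝ) + 1) * j ! * (j + 1) * j₀ ≤ ((j : ℝ) + 1) * j ! * (j + 1) * j := by gcongr
      _ = j ! * ((j + 1) ^ 2 * j) := by ring
      _ ≤ j ! * (4 * j ^ 3) := mul_le_mul_of_nonneg_left hcube hfac.le
      _ ≤ 4 * bigL ν j := by linarith
  have hL0 : (0 : ℝ) ≤ bigL ν j₀ / j₀ := by positivity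
  have hr0 : (0 : ℝ) ≤ r / j₀ := by positivity
  push_cast at *
  have e1 : ((bigL ν j : ℝ) - bigL ν j₀) / j₀ = bigL ν j / j₀ - bigL ν j₀ / j₀ := sub_div _ _ _
  have e2 : 4 * (bigL ν j : ℝ) / j₀ = 4 * (bigL ν j / j₀) := by ring
  have e3 : 5 * ((bigL ν j : ℝ) + r) / j₀ = 5 * (bigL ν j / j₀) + 5 * (r / j₀) := by ring
  rw [e1, e3]
  rw [e2] at hper
  linarith

end Normality

/-! ### Digits of a real number from rational approximations -/

section ComputableReals

theorem isComputableReal_natCast_div (a b : ℕ) : IsComputableReal ((a : ℝ) / b) := by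
  refine ⟨2, le_rfl, fun n => 2 ^ (n + 1) * a / b % 2, ?_, fun n => ?_⟩
  · exact computable_mod (computable_div (computable_mul
      (computable_pow (Computable.const 2) Computable.succ) (Computable.const a))
      (Computable.const b)) (Computable.const 2)
  · have e : ((2 : ℕ) : ℝ) ^ (n + 1) * (a / b) = ((2 ^ (n + 1) * a : ℕ) : ℝ) / (b : ℕ) := by
      push_cast
      ring
    rw [e, ← Int.natCast_floor_eq_floor (by positivity), Nat.floor_div_eq_div]
    push_cast
    rfl

/-- A real number with computable rational approximations `A n / P n`, accurate to `2 / P n`, is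
computable. -/
theorem isComputableReal_of_approx {x : ℝ} {A P : ℕ → ℕ} (hA : Computable A) (hP : Computable P)
    (hpos : ∀ n, 0 < P n) (hP' : Tendsto P atTop atTop) (hlow : ∀ n, A n ≤ P n * x)
    (hupp : ∀ n, P n * x ≤ A n + 2) : IsComputableReal x := by
  have hPr : ∀ n, (0 : ℝ) < P n := fun n => by exact_mod_cast hpos n
  have hx : 0 ≤ x := by
    have := (Nat.cast_nonneg (A 0)).trans (hlow 0)
    exact nonneg_of_mul_nonneg_right this (hPr 0)
  -- The case split is not effective, but only the existence of an algorithm is claimed.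
  by_cases hirr : Irrational x
  · have hval : ∀ k N, 2 ^ (k + 1) * A N / P N = 2 ^ (k + 1) * (A N + 2) / P N →
        ⌊(2 : ℝ) ^ (k + 1) * x⌋ = ((2 ^ (k + 1) * A N / P N : ℕ) : ℤ) := by
      intro k N h
      have h2 : (0 : ℝ) < 2 ^ (k + 1) := by positivity
      have h3 : 2 ^ (k + 1) * A N / P N * P N ≤ 2 ^ (k + 1) * A N := Nat.div_mul_le_self _ _
      have h4 : 2 ^ (k + 1) * (A N + 2) < (2 ^ (k + 1) * A N / P N + 1) * P N := by
        rw [h]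
        exact (Nat.div_lt_iff_lt_mul (hpos N)).1 (Nat.lt_succ_self _)
      set F := 2 ^ (k + 1) * A N / P N
      have h3' : (F : ℝ) * P N ≤ 2 ^ (k + 1) * A N := by exact_mod_cast h3
      have h4' : (2 : ℝ) ^ (k + 1) * (A N + 2) < (F + 1) * P N := by exact_mod_cast h4
      rw [Int.floor_eq_iff]
      push_cast
      constructor
      · refine le_of_mul_le_mul_right ?_ (hPr N)
        nlinarith [mul_le_mul_of_nonneg_left (hlow N) h2.le]
      · refine lt_of_mul_lt_mul_right ?_ (hPr N).le
        nlinarith [mul_le_mul_of_nonneg_left (hupp N) h2.le]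
    -- The search halts: `2 ^ (k + 1) x` is not an integer, so a fine enough enclosure avoids both
    -- neighbouring integers.
    have hex : ∀ k, ∃ N, 2 ^ (k + 1) * A N / P N = 2 ^ (k + 1) * (A N + 2) / P N := by
      intro k
      have h2 : (0 : ℝ) < 2 ^ (k + 1) := by positivity
      have hirr' : Irrational (2 ^ (k + 1) * x) := by
        have := hirr.natCast_mul (m := 2 ^ (k + 1)) (by positivity)
        exact_mod_cast this
      have hy : (0 : ℝ) ≤ 2 ^ (k + 1) * x := by positivity
      set y := (2 : ℝ) ^ (k + 1) * x with hyd
      have hf1 : (⌊y⌋₊ : ℝ) < y := lt_of_le_of_ne (Nat.floor_le hy) fun h =>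
        hirr'.ne_nat _ h.symm
      have hf2 := Nat.lt_floor_add_one y
      set F := ⌊y⌋₊
      obtain ⟨M, hM⟩ := exists_nat_gt (2 ^ (k + 1) * 2 / min (y - F) (F + 1 - y))
      obtain ⟨N, hN⟩ := (hP'.eventually_ge_atTop M).exists
      have hmin : 0 < min (y - F) (F + 1 - y) := lt_min (by linarith) (by linarith)
      have hPN : (2 : ℝ) ^ (k + 1) * 2 < P N * min (y - F) (F + 1 - y) := by
        rw [div_lt_iff₀ hmin] at hM
        refine hM.trans_le ?_
        gcongr
      have hb1 : (2 : ℝ) ^ (k + 1) * 2 < P N * (y - F) :=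
        hPN.trans_le (mul_le_mul_of_nonneg_left (min_le_left _ _) (hPr N).le)
      have hb2 : (2 : ℝ) ^ (k + 1) * 2 < P N * (F + 1 - y) :=
        hPN.trans_le (mul_le_mul_of_nonneg_left (min_le_right _ _) (hPr N).le)
      have hl := mul_le_mul_of_nonneg_left (hlow N) h2.le
      have hu := mul_le_mul_of_nonneg_left (hupp N) h2.le
      have e : (2 : ℝ) ^ (k + 1) * (P N * x) = P N * y := by rw [hyd]; ring
      rw [e] at hl hu
      have hF1 : (F * P N : ℝ) ≤ 2 ^ (k + 1) * A N := by nlinarith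
      have hF2 : (2 : ℝ) ^ (k + 1) * (A N + 2) < (F + 1) * P N := by nlinarith
      have hF1' : F * P N ≤ 2 ^ (k + 1) * A N := by exact_mod_cast hF1
      have hF2' : 2 ^ (k + 1) * (A N + 2) < (F + 1) * P N := by exact_mod_cast hF2
      have hmono : 2 ^ (k + 1) * A N ≤ 2 ^ (k + 1) * (A N + 2) := by gcongr; omega
      refine ⟨N, ?_⟩
      rw [Nat.div_eq_of_lt_le hF1' (hmono.trans_lt hF2'), Nat.div_eq_of_lt_le
        (hF1'.trans hmono) hF2']
    have hA' : Computable fun p : ℕ × ℕ => 2 ^ (p.1 + 1) * A p.2 / P p.2 :=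
      computable_div (computable_mul (computable_pow (Computable.const 2)
        (Computable.succ.comp Computable.fst)) (hA.comp Computable.snd)) (hP.comp Computable.snd)
    have hA2' : Computable fun p : ℕ × ℕ => 2 ^ (p.1 + 1) * (A p.2 + 2) / P p.2 :=
      computable_div (computable_mul (computable_pow (Computable.const 2)
        (Computable.succ.comp Computable.fst))
        (computable_add (hA.comp Computable.snd) (Computable.const 2))) (hP.comp Computable.snd)
    have hsearch := computable_sInf
      (P := fun k N => 2 ^ (k + 1) * A N / P N = 2 ^ (k + 1) * (A N + 2) / P N)
      (computablePred_eq hA' hA2') hex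
    refine ⟨2, le_rfl, _, computable_mod (hA'.comp (Computable.id.pair hsearch))
      (Computable.const 2), fun k => ?_⟩
    have := hval k _ (Nat.sInf_mem (hex k))
    push_cast at this ⊢
    rw [this]
    rfl
  · obtain ⟨r, rfl⟩ : ∃ r : ℚ, (r : ℝ) = x := by
      simpa [Irrational] using hirr
    have hr : 0 ≤ r := by exact_mod_cast hx
    obtain ⟨a, ha⟩ := Int.eq_ofNat_of_zero_le (Rat.num_nonneg.2 hr)
    have := isComputableReal_natCast_div a r.den
    rwa [Rat.cast_def, ha, Int.cast_natCast]

end ComputableReals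

/-! ### Computability of the construction -/

section Construction

variable {q ν : ℕ → ℕ}

theorem computable_prodTo (hq : Computable q) : Computable (prodTo q) := by
  refine (computable_rec (g := fun n r => r * q (n + 1)) 1
    (computable_mul Computable.snd (hq.comp (Computable.succ.comp Computable.fst)))
    Computable.id).of_eq fun n => ?_
  simp only [id_eq]
  induction n with
  | zero => simp [prodTo]
  | succ n ih => rw [prodTo_succ, ← ih]

theorem computable_numerator {a : ℕ → ℕ} (hq : Computable q) (ha : Computable a) :
    Computable (numerator q a) := by
  refine (computable_rec (g := fun n r => r * q (n + 1) + a n) 0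
    (computable_add (computable_mul Computable.snd
      (hq.comp (Computable.succ.comp Computable.fst))) (ha.comp Computable.fst))
    Computable.id).of_eq fun n => ?_
  simp only [id_eq]
  induction n with
  | zero => rfl
  | succ n ih => rw [numerator, ← ih]

theorem computable_ell_succ (hν : Computable ν) :
    Computable fun p : ℕ × ℕ => ell ν (p.1 + 1) p.2 := by
  have hfst : Computable fun p : ℕ × ℕ => p.1 + 1 := Computable.succ.comp Computable.fst
  have hP : ComputablePred fun z : (ℕ × ℕ) × ℕ =>
      ν (z.1.1 + 1) - 1 ≤ z.1.2 + (z.1.1 + 1)! * (z.1.1 + 1) * z.2 := by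
    have h1 := hfst.comp (Computable.fst (α := ℕ × ℕ) (β := ℕ))
    exact computablePred_le (computable_sub (hν.comp h1) (Computable.const 1))
      (computable_add (Computable.snd.comp Computable.fst)
        (computable_mul (computable_mul (computable_factorial h1) h1) Computable.snd))
  exact computable_ite (computablePred_eq hfst (Computable.const 1))
    (Computable.const (max (ν 2 - 1) 1))
    (computable_max (computable_sInf (P := fun (p : ℕ × ℕ) t =>
      ν (p.1 + 1) - 1 ≤ p.2 + (p.1 + 1)! * (p.1 + 1) * t) hP
      fun p => exists_le_add_mul ν p.2 (by omega)) (computable_pow hfst (Computable.const 2)))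

theorem computable_bigL (hν : Computable ν) : Computable (bigL ν) := by
  have hfst : Computable fun p : ℕ × ℕ => p.1 + 1 := Computable.succ.comp Computable.fst
  refine (computable_rec (g := fun n r => r + (n + 1)! * (n + 1) * ell ν (n + 1) r) 0
    (computable_add Computable.snd (computable_mul (computable_mul (computable_factorial hfst) hfst)
      (computable_ell_succ hν))) Computable.id).of_eq fun n => ?_
  simp only [id_eq]
  induction n with
  | zero => rfl
  | succ n ih => rw [bigL_succ, ← ih]

theorem computable_digit_succ (hq : Computable q) (hν : Computable ν) :
    Computable fun n => digit q ν (n + 1) := by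
  have hL := computable_bigL hν
  have hsucc : Computable fun n : ℕ => n + 1 := Computable.succ
  have hstage : Computable fun n => stage ν (n + 1) :=
    computable_sInf (P := fun n i => n + 1 ≤ bigL ν i)
      (computablePred_le (hsucc.comp Computable.fst) (hL.comp Computable.snd))
      fun n => ⟨n + 1, (strictMono_bigL ν).le_apply⟩
  have hcell : Computable fun n => cell ν (n + 1) :=
    computable_mod (computable_div (computable_sub (computable_sub hsucc
      (hL.comp (computable_sub hstage (Computable.const 1)))) (Computable.const 1))
      (computable_factorial hstage)) hstage
  exact computable_div (computable_add (computable_mul (hq.comp hsucc) hcell)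
    (computable_sub hstage (Computable.const 1))) hstage

theorem isComputableReal_xi (hb : IsBasic q) (hq : Computable q) (hν : Computable ν) :
    IsComputableReal (xi q (fun x => x) ν) := by
  rw [xi_eq_tsum_digit]
  have h := tsum_term_bounds (a := fun n => digit q ν (n + 1)) hb (digit_le q ν)
  exact isComputableReal_of_approx (computable_numerator hq (computable_digit_succ hq hν))
    (computable_prodTo hq) (prodTo_pos hb)
    (tendsto_atTop_mono (fun n => Nat.lt_two_pow_self.le.trans (two_pow_le_prodTo hb n)) tendsto_id)
    (fun n => (h n).1) fun n => (h n).2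

theorem bigL_congr {μ : ℕ → ℕ} (h : ∀ j, 1 ≤ j → μ j = ν j) : bigL μ = bigL ν := by
  ext n
  induction n with
  | zero => rfl
  | succ n ih =>
    rw [bigL_succ, bigL_succ, ih]
    simp only [ell, h 2 (by omega), h (n + 1) (by omega)]

theorem xi_congr {μ : ℕ → ℕ} (g : ℝ → ℝ) (h : ∀ j, 1 ≤ j → μ j = ν j) : xi q g μ = xi q g ν := by
  simp only [xi, alpha, cell, stage, bigL_congr h]

theorem computable_growthIndex (hb : IsBasic q) (hq : Computable q) (hgrow : ComputablyGrowing q) :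
    Computable (growthIndex q) := by
  have hsub : Computable fun z : ℕ × ℕ => z.2 - 1 :=
    computable_sub Computable.snd (Computable.const 1)
  exact computable_max hgrow.2 (computable_sInf (P := fun N t => 1 ≤ t ∧ N ≤ prodTo q (t - 1))
    (computablePred_and (computablePred_le (Computable.const 1) Computable.snd)
      (computablePred_le Computable.fst ((computable_prodTo hq).comp hsub)))
    (exists_le_prodTo hb))

theorem exists_computable_ge_nu (hb : IsBasic q) (hq : Computable q) (hgrow : ComputablyGrowing q) :
    ∃ ν : ℕ → ℕ, Computable ν ∧ ∀ j, 1 ≤ j → nu q (fun x => x) j ≤ ν j := by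
  have h4 : Computable fun j : ℕ => 4 * j := computable_mul (Computable.const 4) Computable.id
  refine ⟨fun j => growthIndex q ((4 * j) ^ (4 * j)),
    (computable_growthIndex hb hq hgrow).comp (computable_pow h4 h4), fun j hj => ?_⟩
  rw [nu_eq_growthIndex hb hgrow.1 hj]
  have hle : ⌈threshold j⌉₊ ≤ (4 * j) ^ (4 * j) := Nat.ceil_le.2 (threshold_le_pow hj)
  obtain ⟨h1, h2⟩ := (isLeast_growthIndex hb hgrow.1 ((4 * j) ^ (4 * j))).1
  exact (isLeast_growthIndex hb hgrow.1 _).2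
    ⟨h1, fun k hk => ⟨hle.trans (h2 k hk).1, hle.trans (h2 k hk).2⟩⟩

end Construction

/-! ### Comparing integers with powers of `e` -/

section Exponential

/-- Witnesses, through `exp 1 < (1 + 1 / (n + 1)) ^ (n + 2)`, that `exp k < X`. -/
def ExpLT (k X n : ℕ) : Prop := (n + 2) ^ ((n + 2) * k) < X * (n + 1) ^ ((n + 2) * k)

/-- Witnesses, through `(1 + 1 / (n + 1)) ^ (n + 1) < exp 1`, that `X < exp k`. -/
def LTExp (X k n : ℕ) : Prop := X * (n + 1) ^ ((n + 1) * k) < (n + 2) ^ ((n + 1) * k)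

theorem expLT_iff (k X n : ℕ) :
    ExpLT k X n ↔ (1 + 1 / ((n + 1 : ℕ) : ℝ)) ^ ((n + 2) * k) < X := by
  have h : (0 : ℝ) < ((n + 1 : ℕ) : ℝ) ^ ((n + 2) * k) := by positivity
  have e : 1 + 1 / ((n + 1 : ℕ) : ℝ) = ((n + 2 : ℕ) : ℝ) / ((n + 1 : ℕ) : ℝ) := by
    push_cast
    field_simp
    ring
  rw [ExpLT, e, div_pow, div_lt_iff₀ h]
  exact_mod_cast Iff.rfl

theorem ltExp_iff (X k n : ℕ) :
    LTExp X k n ↔ (X : ℝ) < (1 + 1 / ((n + 1 : ℕ) : ℝ)) ^ ((n + 1) * k) := by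
  have h : (0 : ℝ) < ((n + 1 : ℕ) : ℝ) ^ ((n + 1) * k) := by positivity
  have e : 1 + 1 / ((n + 1 : ℕ) : ℝ) = ((n + 2 : ℕ) : ℝ) / ((n + 1 : ℕ) : ℝ) := by
    push_cast
    field_simp
    ring
  rw [LTExp, e, div_pow, lt_div_iff₀ h]
  exact_mod_cast Iff.rfl

theorem exp_lt_of_expLT {k X n : ℕ} (h : ExpLT k X n) : Real.exp k < X := by
  rw [expLT_iff] at h
  refine lt_of_le_of_lt ?_ h
  have hx : (0 : ℝ) < 1 + 1 / ((n + 1 : ℕ) : ℝ) := by positivity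
  -- At `x = 1 + 1 / (n + 1)` the bound `1 - 1 / x ≤ log x` reads `1 / (n + 2) ≤ log x`.
  have hlog := Real.one_sub_inv_le_log_of_pos hx
  have e : 1 - (1 + 1 / ((n + 1 : ℕ) : ℝ))⁻¹ = 1 / ((n : ℝ) + 2) := by
    push_cast
    field_simp
    ring
  rw [e, Real.le_log_iff_exp_le hx] at hlog
  calc Real.exp k = Real.exp (1 / ((n : ℝ) + 2)) ^ ((n + 2) * k) := by
        rw [← Real.exp_nat_mul]
        congr 1
        push_cast
        field_simp
    _ ≤ _ := by gcongr

theorem lt_exp_of_ltExp {X k n : ℕ} (h : LTExp X k n) : (X : ℝ) < Real.exp k := by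
  rw [ltExp_iff] at h
  refine h.trans_le ?_
  calc (1 + 1 / ((n + 1 : ℕ) : ℝ)) ^ ((n + 1) * k)
      ≤ Real.exp (1 / ((n + 1 : ℕ) : ℝ)) ^ ((n + 1) * k) := by
        gcongr
        rw [add_comm]
        exact Real.add_one_le_exp _
    _ = Real.exp k := by
        rw [← Real.exp_nat_mul]
        congr 1
        push_cast
        field_simp

theorem tendsto_one_add_div_pow_mul (k : ℕ) :
    Tendsto (fun n : ℕ => (1 + 1 / ((n + 1 : ℕ) : ℝ)) ^ ((n + 1) * k)) atTop (𝓝 (Real.exp k)) := by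
  have h := ((Real.tendsto_one_add_div_pow_exp 1).comp (tendsto_add_atTop_nat 1)).pow k
  rw [← Real.exp_nat_mul, mul_one] at h
  refine h.congr fun n => ?_
  rw [pow_mul]
  rfl

theorem eventually_ltExp {X k : ℕ} (h : (X : ℝ) < Real.exp k) : ∀ᶠ n in atTop, LTExp X k n := by
  filter_upwards [(tendsto_one_add_div_pow_mul k).eventually_const_lt h] with n hn
  exact (ltExp_iff X k n).2 hn

theorem eventually_expLT {k X : ℕ} (h : Real.exp k < X) : ∀ᶠ n in atTop, ExpLT k X n := by
  -- The exponent `(n + 2) k` exceeds `(n + 1) k` by `k`; this extra factor tends to `1`.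
  have h1 : Tendsto (fun n : ℕ => (1 + 1 / ((n + 1 : ℕ) : ℝ)) ^ k) atTop (𝓝 1) := by
    have := ((tendsto_one_div_add_atTop_nhds_zero_nat (𝕜 := ℝ)).const_add 1).pow k
    rw [add_zero, one_pow] at this
    exact_mod_cast this
  have h2 := (tendsto_one_add_div_pow_mul k).mul h1
  rw [mul_one] at h2
  filter_upwards [h2.eventually_lt_const h] with n hn
  rw [expLT_iff]
  refine lt_of_eq_of_lt ?_ hn
  rw [← pow_add]
  congr 1
  ring

end Exponential

/-! ### Semidecidability of strict inequalities with `exp (log a ^ 2)` -/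

section SemiDecidability

/-- Witnesses that `N < exp (log a ^ 2)`, through a fraction `c.1 / c.2.1` below `log a`. -/
def LTExpLogSq (a N : ℕ) (c : ℕ × ℕ × ℕ) : Prop :=
  ExpLT c.1 (a ^ c.2.1) c.2.2 ∧ LTExp (N ^ (c.2.1 * c.2.1)) (c.1 * c.1) c.2.2

/-- Witnesses that `exp (log a ^ 2) < N`, through a fraction `c.1 / c.2.1` above `log a`. -/
def ExpLogSqLT (a N : ℕ) (c : ℕ × ℕ × ℕ) : Prop :=
  LTExp (a ^ c.2.1) c.1 c.2.2 ∧ ExpLT (c.1 * c.1) (N ^ (c.2.1 * c.2.1)) c.2.2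

theorem pow_eq_exp_mul_log {a : ℕ} (ha : 1 ≤ a) (s : ℕ) :
    ((a ^ s : ℕ) : ℝ) = Real.exp (s * Real.log a) := by
  have : (0 : ℝ) < a := by exact_mod_cast ha
  rw [Real.exp_nat_mul, Real.exp_log this, Nat.cast_pow]

theorem exp_log_sq_pow (a s : ℕ) :
    Real.exp (Real.log a ^ 2) ^ (s * s) = Real.exp ((s * Real.log a) * (s * Real.log a)) := by
  rw [← Real.exp_nat_mul]
  congr 1
  push_cast
  ring

/-- The first witness says `p < s log a`, the second `N ^ (s ^ 2) < exp (p ^ 2)`; together they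
compare the `s ^ 2`-th powers. No condition `s ≠ 0` is needed, as zeroth powers are never strictly
ordered. -/
theorem lt_of_ltExpLogSq {a N : ℕ} (ha : 1 ≤ a) {c : ℕ × ℕ × ℕ} (h : LTExpLogSq a N c) :
    (N : ℝ) < Real.exp (Real.log a ^ 2) := by
  obtain ⟨p, s, n⟩ := c
  have h1 := exp_lt_of_expLT h.1
  have h2 := lt_exp_of_ltExp h.2
  simp only at h1 h2
  rw [pow_eq_exp_mul_log ha, Real.exp_lt_exp] at h1
  refine lt_of_pow_lt_pow_left₀ (s * s) (Real.exp_pos _).le ?_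
  rw [exp_log_sq_pow]
  push_cast at h2
  refine h2.trans_le (Real.exp_le_exp.2 ?_)
  gcongr

theorem lt_of_expLogSqLT {a N : ℕ} (ha : 1 ≤ a) {c : ℕ × ℕ × ℕ} (h : ExpLogSqLT a N c) :
    Real.exp (Real.log a ^ 2) < N := by
  obtain ⟨p, s, n⟩ := c
  have h1 := lt_exp_of_ltExp h.1
  have h2 := exp_lt_of_expLT h.2
  simp only at h1 h2
  rw [pow_eq_exp_mul_log ha, Real.exp_lt_exp] at h1
  refine lt_of_pow_lt_pow_left₀ (s * s) (Nat.cast_nonneg _) ?_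
  rw [exp_log_sq_pow]
  push_cast at h2
  refine lt_of_le_of_lt (Real.exp_le_exp.2 ?_) h2
  have : 0 ≤ (s : ℝ) * Real.log a := mul_nonneg (Nat.cast_nonneg _) (Real.log_natCast_nonneg a)
  gcongr

theorem exists_natCast_div_btwn {x y : ℝ} (hx : 0 ≤ x) (h : x < y) :
    ∃ p s : ℕ, 0 < s ∧ s * x < p ∧ p < s * y := by
  obtain ⟨r, hr1, hr2⟩ := exists_rat_btwn h
  have hr : 0 ≤ r := by exact_mod_cast hx.trans hr1.le
  obtain ⟨p, hp⟩ := Int.eq_ofNat_of_zero_le (Rat.num_nonneg.2 hr)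
  have hs : (0 : ℝ) < r.den := by exact_mod_cast r.den_pos
  rw [Rat.cast_def, hp, Int.cast_natCast] at hr1 hr2
  exact ⟨p, r.den, r.den_pos, (lt_div_iff₀' hs).1 hr1, (div_lt_iff₀' hs).1 hr2⟩

theorem exists_ltExpLogSq {a N : ℕ} (ha : 2 ≤ a) (h : (N : ℝ) < Real.exp (Real.log a ^ 2)) :
    ∃ c, LTExpLogSq a N c := by
  have hL : 0 < Real.log a := Real.log_pos (by exact_mod_cast ha)
  have hlog : Real.log N < Real.log a ^ 2 := by
    rcases N.eq_zero_or_pos with rfl | hN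
    · simp only [Nat.cast_zero, Real.log_zero]; positivity
    · exact (Real.log_lt_iff_lt_exp (by exact_mod_cast hN)).2 h
  -- The fraction `p / s` lies strictly between `√(log N)` and `log a`. For `N = 0` the convention
  -- `log 0 = 0` keeps this meaningful.
  obtain ⟨p, s, hs, h1, h2⟩ := exists_natCast_div_btwn (Real.sqrt_nonneg (Real.log N))
    ((Real.sqrt_lt' hL).2 hlog)
  have e1 : Real.exp p < ((a ^ s : ℕ) : ℝ) := by
    rw [pow_eq_exp_mul_log (by omega)]
    exact Real.exp_lt_exp.2 h2
  have e2 : ((N ^ (s * s) : ℕ) : ℝ) < Real.exp ((p * p : ℕ) : ℝ) := by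
    rcases N.eq_zero_or_pos with rfl | hN
    · rw [zero_pow (Nat.mul_pos hs hs).ne', Nat.cast_zero]
      exact Real.exp_pos _
    · rw [pow_eq_exp_mul_log hN]
      refine Real.exp_lt_exp.2 ?_
      push_cast
      calc (s : ℝ) * s * Real.log N = (s * √(Real.log N)) * (s * √(Real.log N)) := by
            rw [mul_mul_mul_comm, Real.mul_self_sqrt (Real.log_natCast_nonneg N)]
        _ < p * p := mul_self_lt_mul_self (by positivity) h1
  obtain ⟨n, hn1, hn2⟩ := ((eventually_expLT e1).and (eventually_ltExp e2)).exists
  exact ⟨(p, s, n), hn1, hn2⟩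

theorem exists_expLogSqLT {a N : ℕ} (ha : 1 ≤ a) (h : Real.exp (Real.log a ^ 2) < N) :
    ∃ c, ExpLogSqLT a N c := by
  have hL : 0 ≤ Real.log a := Real.log_natCast_nonneg a
  have hN : 0 < N := by exact_mod_cast (Real.exp_pos _).trans h
  have hlog : Real.log a ^ 2 < Real.log N :=
    (Real.lt_log_iff_exp_lt (by exact_mod_cast hN)).2 h
  obtain ⟨p, s, hs, h1, h2⟩ := exists_natCast_div_btwn hL (Real.lt_sqrt_of_sq_lt hlog)
  have e1 : ((a ^ s : ℕ) : ℝ) < Real.exp p := by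
    rw [pow_eq_exp_mul_log ha]
    exact Real.exp_lt_exp.2 h1
  have e2 : Real.exp ((p * p : ℕ) : ℝ) < ((N ^ (s * s) : ℕ) : ℝ) := by
    rw [pow_eq_exp_mul_log hN]
    refine Real.exp_lt_exp.2 ?_
    push_cast
    calc (p : ℝ) * p < (s * √(Real.log N)) * (s * √(Real.log N)) :=
          mul_self_lt_mul_self (by positivity) h2
      _ = (s : ℝ) * s * Real.log N := by
          rw [mul_mul_mul_comm, Real.mul_self_sqrt (Real.log_natCast_nonneg N)]
  obtain ⟨n, hn1, hn2⟩ := ((eventually_ltExp e1).and (eventually_expLT e2)).exists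
  exact ⟨(p, s, n), hn1, hn2⟩

variable {α : Type*} [Primcodable α]

theorem computablePred_expLT {k X n : α → ℕ} (hk : Computable k) (hX : Computable X)
    (hn : Computable n) : ComputablePred fun a => ExpLT (k a) (X a) (n a) := by
  have h1 := computable_add hn (Computable.const 1)
  have h2 := computable_add hn (Computable.const 2)
  have he := computable_mul h2 hk
  exact computablePred_lt (computable_pow h2 he) (computable_mul hX (computable_pow h1 he))

theorem computablePred_ltExp {X k n : α → ℕ} (hX : Computable X) (hk : Computable k)
    (hn : Computable n) : ComputablePred fun a => LTExp (X a) (k a) (n a) := by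
  have h1 := computable_add hn (Computable.const 1)
  have h2 := computable_add hn (Computable.const 2)
  have he := computable_mul h1 hk
  exact computablePred_lt (computable_mul hX (computable_pow h1 he)) (computable_pow h2 he)

theorem computablePred_ltExpLogSq {a N : α → ℕ} {c : α → ℕ × ℕ × ℕ} (ha : Computable a)
    (hN : Computable N) (hc : Computable c) :
    ComputablePred fun z => LTExpLogSq (a z) (N z) (c z) := by
  have hp := Computable.fst.comp hc
  have hs := Computable.fst.comp (Computable.snd.comp hc)
  have hn := Computable.snd.comp (Computable.snd.comp hc)
  exact computablePred_and (computablePred_expLT hp (computable_pow ha hs) hn)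
    (computablePred_ltExp (computable_pow hN (computable_mul hs hs)) (computable_mul hp hp) hn)

theorem computablePred_expLogSqLT {a N : α → ℕ} {c : α → ℕ × ℕ × ℕ} (ha : Computable a)
    (hN : Computable N) (hc : Computable c) :
    ComputablePred fun z => ExpLogSqLT (a z) (N z) (c z) := by
  have hp := Computable.fst.comp hc
  have hs := Computable.fst.comp (Computable.snd.comp hc)
  have hn := Computable.snd.comp (Computable.snd.comp hc)
  exact computablePred_and (computablePred_ltExp (computable_pow ha hs) hp hn)
    (computablePred_expLT (computable_mul hp hp) (computable_pow hN (computable_mul hs hs)) hn)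

end SemiDecidability

/-! ### Computing the ceilings of the thresholds -/

section LeastChoice

theorem threshold_eq (j : ℕ) : threshold j = Real.exp (Real.log ((4 * j : ℕ) : ℝ) ^ 2) := by
  rw [threshold]
  push_cast
  rfl

theorem rpow_log_eq_threshold {j : ℕ} (hj : 1 ≤ j) :
    (4 * (j : ℝ)) ^ Real.log (4 * (j : ℝ)) = threshold j := by
  have : (0 : ℝ) < 4 * j := by
    have : (0 : ℝ) < j := by exact_mod_cast hj
    positivity
  rw [Real.rpow_def_of_pos this, threshold, sq]

/-- The ceilings of the thresholds are computable once it is decidable which of the thresholds are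
integers: this fixes the length of the interval of integers that has to be searched for. -/
theorem computable_ceil_threshold
    (hD : ComputablePred fun j : ℕ =>
      ∃ N : ℕ, (4 * (j : ℝ)) ^ Real.log (4 * (j : ℝ)) = (N : ℝ)) :
    Computable fun j : ℕ => ⌈threshold (j + 1)⌉₊ - 1 := by
  classical
  set D : ℕ → Prop := fun j => ∃ N : ℕ, threshold (j + 1) = N with hDdef
  have hD' : ComputablePred D := by
    refine (computablePred_comp hD Computable.succ).of_eq fun j => ?_
    simp only [hDdef, Nat.succ_eq_add_one, rpow_log_eq_threshold (Nat.succ_pos j)]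
  set d : ℕ → ℕ := fun j => if D j then 1 else 0 with hd
  have hdc : Computable d := computable_ite hD' (Computable.const 1) (Computable.const 0)
  have ha : Computable fun j : ℕ => 4 * (j + 1) := computable_mul (Computable.const 4)
    Computable.succ
  -- Search for `M < θ < M + 1 + d`, with witnesses for both inequalities. If `θ` is an integer, `d
  -- = 1` and `θ = M + 1`; otherwise `d = 0` and `M = ⌊θ⌋`. Both inequalities are strict, and in
  -- both cases `M + 1 = ⌈θ⌉`.
  refine computable_of_search (γ := (ℕ × ℕ × ℕ) × ℕ × ℕ × ℕ)
    (R := fun j M c => LTExpLogSq (4 * (j + 1)) M c.1 ∧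
      ExpLogSqLT (4 * (j + 1)) (M + 1 + d j) c.2) ?_ ?_ ?_
  · have hj : Computable fun z : ℕ × ℕ × (ℕ × ℕ × ℕ) × ℕ × ℕ × ℕ => z.1 := Computable.fst
    have hM : Computable fun z : ℕ × ℕ × (ℕ × ℕ × ℕ) × ℕ × ℕ × ℕ => z.2.1 :=
      Computable.fst.comp Computable.snd
    have hc : Computable fun z : ℕ × ℕ × (ℕ × ℕ × ℕ) × ℕ × ℕ × ℕ => z.2.2 :=
      Computable.snd.comp Computable.snd
    exact computablePred_and
      (computablePred_ltExpLogSq (ha.comp hj) hM (Computable.fst.comp hc))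
      (computablePred_expLogSqLT (ha.comp hj)
        (computable_add (computable_add hM (Computable.const 1)) (hdc.comp hj))
        (Computable.snd.comp hc))
  · intro j
    have hpos : 0 < ⌈threshold (j + 1)⌉₊ := Nat.ceil_pos.2 (Real.exp_pos _)
    obtain ⟨M, hM⟩ := Nat.exists_eq_add_of_le' hpos
    have h1 : (M : ℝ) < threshold (j + 1) := Nat.lt_ceil.1 (by omega)
    have h2 : threshold (j + 1) < ((M + 1 + d j : ℕ) : ℝ) := by
      have hle := Nat.le_ceil (threshold (j + 1))
      rw [hM] at hle
      by_cases hj : D j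
      · simp only [hd, if_pos hj]
        exact hle.trans_lt (by exact_mod_cast Nat.lt_succ_self _)
      · simp only [hd, if_neg hj, add_zero]
        exact lt_of_le_of_ne hle fun h => hj ⟨_, h⟩
    rw [threshold_eq] at h1 h2
    obtain ⟨c₁, hc₁⟩ := exists_ltExpLogSq (by omega) h1
    obtain ⟨c₂, hc₂⟩ := exists_expLogSqLT (by omega) h2
    exact ⟨M, (c₁, c₂), hc₁, hc₂⟩
  · rintro j M ⟨c₁, c₂⟩ ⟨hc₁, hc₂⟩
    have h1 := lt_of_ltExpLogSq (by omega) hc₁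
    have h2 := lt_of_expLogSqLT (by omega) hc₂
    rw [← threshold_eq] at h1 h2
    suffices h : ⌈threshold (j + 1)⌉₊ = M + 1 by omega
    by_cases hj : D j
    · simp only [hd, if_pos hj] at h2
      obtain ⟨N, hN⟩ := hj
      rw [hN] at h1 h2 ⊢
      rw [Nat.ceil_natCast]
      have h1' : M < N := by exact_mod_cast h1
      have h2' : N < M + 1 + 1 := by exact_mod_cast h2
      omega
    · simp only [hd, if_neg hj, add_zero] at h2
      refine le_antisymm (Nat.ceil_le.2 h2.le) (Nat.lt_ceil.2 h1)

theorem isComputableReal_xi_nu {q : ℕ → ℕ} (hb : IsBasic q) (hq : Computable q)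
    (hgrow : ComputablyGrowing q)
    (hD : ComputablePred fun j : ℕ =>
      ∃ N : ℕ, (4 * (j : ℝ)) ^ Real.log (4 * (j : ℝ)) = (N : ℝ)) :
    IsComputableReal (xi q (fun x => x) (nu q (fun x => x))) := by
  -- This sequence agrees with `ν*` for `j ≥ 1`; the value at `0` does not affect `ξ`, by
  -- `xi_congr`.
  have hν : Computable fun j : ℕ => growthIndex q (⌈threshold (j - 1 + 1)⌉₊ - 1 + 1) :=
    (computable_growthIndex hb hq hgrow).comp (Computable.succ.comp
      ((computable_ceil_threshold hD).comp Computable.pred))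
  have h := isComputableReal_xi hb hq hν
  rwa [xi_congr (ν := nu q (fun x => x))] at h
  intro j hj
  have hpos : 0 < ⌈threshold j⌉₊ := Nat.ceil_pos.2 (Real.exp_pos _)
  rw [Nat.sub_add_cancel hj, Nat.sub_add_cancel hpos, nu_eq_growthIndex hb hgrow.1 hj]

end LeastChoice

end CantorSeries

theorem mainTheorem9 (q : ℕ → ℕ) (hbasic : CantorSeries.IsBasic q) (hcomp : Computable q)
    (hgrow : CantorSeries.ComputablyGrowing q) :
    -- the number is normal for every choice of `ν` at or above the least one, and computable
    -- whenever `ν` is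
    (∀ ν : ℕ → ℕ, (∀ j, 1 ≤ j → CantorSeries.nu q (fun x => x) j ≤ ν j) →
      Summable (fun n : ℕ => (CantorSeries.alpha q (fun x => x) ν (n + 1) : ℝ) /
        (CantorSeries.prodTo q (n + 1) : ℝ)) ∧
      CantorSeries.IsDistributionNormal q (CantorSeries.xi q (fun x => x) ν) ∧
      (Computable ν → CantorSeries.IsComputableReal (CantorSeries.xi q (fun x => x) ν))) ∧
    -- a computable choice of `ν` exists
    (∃ ν : ℕ → ℕ, Computable ν ∧ ∀ j, 1 ≤ j → CantorSeries.nu q (fun x => x) j ≤ ν j) ∧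
    -- the least choice of `ν` gives a computable number as soon as it is decidable for which `j`
    -- the threshold `(4 j) ^ log (4 j)` is an integer
    (ComputablePred (fun j : ℕ => ∃ N : ℕ, (4 * (j : ℝ)) ^ Real.log (4 * (j : ℝ)) = (N : ℝ)) →
      CantorSeries.IsComputableReal
        (CantorSeries.xi q (fun x => x) (CantorSeries.nu q (fun x => x)))) := by
  refine ⟨fun ν hν => ⟨CantorSeries.summable_alpha_div hbasic ν,
    CantorSeries.isDistributionNormal_xi hbasic hgrow.1 hν,
    CantorSeries.isComputableReal_xi hbasic hcomp⟩,
    CantorSeries.exists_computable_ge_nu hbasic hcomp hgrow,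
    CantorSeries.isComputableReal_xi_nu hbasic hcomp hgrow⟩
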